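/- Let $P$ be a monic polynomial with complex coefficients, of degree $n\ge 1$. For $t\in\mathbb{R}$ let $E_P(t)=\{z\in\mathbb{C}:\ \ln|P(z)|=t\}$ and let $|E_P(t)|$ be its length (one-dimensional Hausdorff measure). Let $$T(P)=\max_{\zeta:\,P'(\zeta)=0}\ln|P(\zeta)|\in[-\infty,+\infty),$$ where $\ln 0=-\infty$ and the maximum over the empty set (which occurs only for $n=1$) is $-\infty$. Then $|E_P(t)|<\infty$ for all real $t\ge T(P)$, and the function $$f(t)=|E_P(t)|\,e^{-t/n}$$ is completely monotonic in $[T(P),+\infty)$. That is, $f$ is continuous at all real $t\ge T(P)$, relative to the set of such $t$, it has derivatives of all orders in $(T(P),+\infty)$, and $$(-1)^k f^{(k)}(t)\ge 0\qquad\text{for all } t>T(P),\ k=0,1,2,\dots$$ (If $T(P)=-\infty$, both intervals are read as $(-\infty,+\infty)$.) -/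

import Mathlib

open MeasureTheory
open scoped ContDiff

noncomputable section

/-- `ln |w|` as an extended real number, with `ln |0| = -∞`. -/
def logAbs (w : ℂ) : EReal := ENNReal.log ‖w‖ₑ

/-- The `t`-level set `E_f(t) = {z : ln |f z| = t}` of a function `f`. -/
def levelSet (f : ℂ → ℂ) (t : ℝ) : Set ℂ := {z : ℂ | logAbs (f z) = (t : EReal)}

/-- The length of a plane set, as its one-dimensional Hausdorff measure. -/
def planeLength (E : Set ℂ) : ENNReal := Measure.hausdorffMeasure (1 : ℝ) E

/-- `T(P)`, the largest value of `ln |P|` at the critical points of `P`, an extended real number.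
For a polynomial of positive degree there are finitely many critical points, so that the supremum
is a maximum as soon as there is one. It is `-∞` exactly when `P` vanishes at all its critical
points, in particular when there are none. -/
def largestCriticalValue (P : Polynomial ℂ) : EReal :=
  ⨆ ζ ∈ {z : ℂ | P.derivative.IsRoot z}, logAbs (P.eval ζ)

/-- `f` is completely monotonic in the open interval `(a, b)`, where `-∞ ≤ a` and `b ≤ +∞`:
it has derivatives of all orders there, and `(-1)^k f^(k) ≥ 0` for all `k ≥ 0`. -/
def CompletelyMonotonicIoo (f : ℝ → ℝ) (a b : EReal) : Prop :=
  ContDiffOn ℝ ∞ f {t : ℝ | a < (t : EReal) ∧ (t : EReal) < b} ∧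
    ∀ (k : ℕ) (t : ℝ), a < (t : EReal) → (t : EReal) < b → 0 ≤ (-1) ^ k * iteratedDeriv k f t

/-- `f` is completely monotonic in `[a, b)`: it is continuous there and completely monotonic in
`(a, b)`. For `a = -∞` this is complete monotonicity in `(-∞, b)`. -/
def CompletelyMonotonicIco (f : ℝ → ℝ) (a b : EReal) : Prop :=
  ContinuousOn f {t : ℝ | a ≤ (t : EReal) ∧ (t : EReal) < b} ∧ CompletelyMonotonicIoo f a b

end

/-! Write `n` for the degree. Away from critical values the equation `P z = exp s` has `n` analytic
branches `Z i`, and on the vertical line `Re s = t` they parametrize the level set by the argument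
of `P`. Its length is therefore the integral over `-π < θ ≤ π` of `∑ ‖(Z i)'‖ = exp t * ∑ 1 / ‖P'‖`
at `s = t + iθ` (`hausdorffMeasure_expLevelSet`).

After multiplication by `exp (-t / n)` the integrand is a sum of `‖g i‖` with `g i = exp (-s / n) *
(Z i)'` analytic and without zeros when `Re s > T(P)`. Locally `‖g i‖ = ‖h i‖ ^ 2` for an analytic
square root `h i`, and the Laplacian of `∑ ‖h i‖ ^ 2` is `∑ ‖2 * (h i)'‖ ^ 2`, a function of the
same kind. Hence all iterated Laplacians are nonnegative. The integrand has period `2πi`, so the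
vertical second derivative integrates to zero and integrating the Laplacian gives `f''`. Thus every
derivative of `f` of even order is nonnegative (`verticalIntegral_completelyMonotone`).

The odd orders follow from boundedness near `+∞`: a convex function bounded there cannot increase,
and this propagates to higher orders (`odd_derivatives_nonpos`). Boundedness holds because `‖P'‖` is
at least a constant times `‖P‖ ^ (1 - 1 / n)` where `‖P‖` is large.

Finiteness and continuity, in particular at `T(P)`, rest on `exists_norm_eval_sub_pow_le`: near a
critical value `v` the integrand grows at most like `‖exp s - v‖ ^ (-(1 - 1 / n))`, which along
vertical lines is dominated by an integrable power of a sine. Both hold at every real `t`. -/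

/-! ### Analytic branches of the inverse of a polynomial -/

open Polynomial Filter Topology Set in
/-- A polynomial has an analytic local inverse near a point that is not critical. -/
theorem Polynomial.exists_analyticAt_rightInverse (P : ℂ[X]) (z : ℂ)
    (hz : P.derivative.eval z ≠ 0) :
    ∃ g : ℂ → ℂ, AnalyticAt ℂ g (P.eval z) ∧ g (P.eval z) = z ∧
      ∀ᶠ u in 𝓝 (P.eval z), P.eval (g u) = u := by
  have hc : ContDiffAt ℂ ω (fun x => P.eval x) z :=
    (AnalyticOnNhd.eval_polynomial P z trivial).contDiffAt
  have hf : HasFDerivAt (fun x => P.eval x)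
      ((ContinuousLinearEquiv.unitsEquivAut ℂ (Units.mk0 _ hz) : ℂ ≃L[ℂ] ℂ) : ℂ →L[ℂ] ℂ) z := by
    refine (P.hasDerivAt z).hasFDerivAt.congr_fderiv ?_
    ext
    simp
  have hn : (ω : WithTop ℕ∞) ≠ 0 := by simp
  refine ⟨hc.localInverse hf hn, ?_, hc.localInverse_apply_image hf hn, ?_⟩
  · exact (hc.to_localInverse hf hn).analyticAt
  · exact (hc.hasStrictFDerivAt' hf hn).eventually_right_inverse

open Polynomial in
/-- The set of solutions of `P z = u`. -/
noncomputable def Polynomial.fiber (P : ℂ[X]) (u : ℂ) : Finset ℂ := (P - C u).roots.toFinset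

namespace Polynomial

open Filter Topology Set

variable {P : ℂ[X]}

theorem sub_C_ne_zero (hP : 1 ≤ P.natDegree) (u : ℂ) : P - C u ≠ 0 := by
  intro h
  rw [sub_eq_zero] at h
  rw [h, natDegree_C] at hP
  omega

theorem mem_fiber (hP : 1 ≤ P.natDegree) {u z : ℂ} : z ∈ P.fiber u ↔ P.eval z = u := by
  rw [fiber, Multiset.mem_toFinset, mem_roots (sub_C_ne_zero hP u)]
  simp [sub_eq_zero]

theorem card_fiber_le (P : ℂ[X]) (u : ℂ) : (P.fiber u).card ≤ P.natDegree := by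
  refine (Multiset.toFinset_card_le _).trans ((card_roots' _).trans ?_)
  rw [natDegree_sub_C]

theorem card_fiber (hP : 1 ≤ P.natDegree) {u : ℂ}
    (hu : ∀ z, P.eval z = u → P.derivative.eval z ≠ 0) : (P.fiber u).card = P.natDegree := by
  have hnd : (P - C u).roots.Nodup := by
    rw [Multiset.nodup_iff_count_le_one]
    intro a
    rw [count_roots]
    by_contra! h
    have := (one_lt_rootMultiplicity_iff_isRoot (sub_C_ne_zero hP u)).1 h
    refine hu a ?_ ?_
    · simpa [sub_eq_zero] using this.1
    · simpa using this.2
  rw [fiber, Multiset.toFinset_card_of_nodup hnd, IsAlgClosed.card_roots_eq_natDegree,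
    natDegree_sub_C]

/-- Near a point `s` for which `exp s` is not a critical value, the solutions `z` of `P z = exp s` are
the values of analytic branches that are pairwise distinct. -/
theorem exists_branches (hP : 1 ≤ P.natDegree) {s₀ : ℂ}
    (hs : ∀ z, P.eval z = Complex.exp s₀ → P.derivative.eval z ≠ 0) :
    ∃ Z : ℂ → ℂ → ℂ, (∀ i ∈ P.fiber (Complex.exp s₀), AnalyticAt ℂ (Z i) s₀ ∧ Z i s₀ = i) ∧
      ∀ᶠ s in 𝓝 s₀, InjOn (fun i => Z i s) (P.fiber (Complex.exp s₀)) ∧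
        P.fiber (Complex.exp s) = (P.fiber (Complex.exp s₀)).image (fun i => Z i s) := by
  classical
  set r := P.fiber (Complex.exp s₀) with hr
  have hg : ∀ i ∈ r, ∃ g : ℂ → ℂ, AnalyticAt ℂ g s₀ ∧ g s₀ = i ∧
      ∀ᶠ s in 𝓝 s₀, P.eval (g s) = Complex.exp s := by
    intro i hi
    have hi' : P.eval i = Complex.exp s₀ := (mem_fiber hP).1 hi
    obtain ⟨g, g1, g2, g3⟩ := P.exists_analyticAt_rightInverse i (hs i hi')
    rw [hi'] at g1 g2 g3
    exact ⟨fun s => g (Complex.exp s), g1.comp (f := Complex.exp) (by fun_prop), g2,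
      (Complex.continuous_exp.tendsto s₀).eventually g3⟩
  choose! Z hZ1 hZ2 hZ3 using hg
  refine ⟨Z, fun i hi => ⟨hZ1 i hi, hZ2 i hi⟩, ?_⟩
  have hinj : ∀ᶠ s in 𝓝 s₀, ∀ i ∈ r, ∀ j ∈ r, i ≠ j → Z i s ≠ Z j s := by
    rw [r.eventually_all]
    intro i hi
    rw [r.eventually_all]
    intro j hj
    rw [eventually_imp_distrib_left]
    intro hij
    exact (hZ1 i hi).continuousAt.ne_iff_eventually_ne (hZ1 j hj).continuousAt |>.1
      (by rwa [hZ2 i hi, hZ2 j hj])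
  filter_upwards [hinj, (r.eventually_all).2 hZ3] with s h1 h2
  have hI : InjOn (fun i => Z i s) r := by
    intro i hi j hj hij
    by_contra h
    exact h1 i hi j hj h hij
  refine ⟨hI, ?_⟩
  symm
  -- The branches already give `n` distinct solutions, and no fiber has more than `n`.
  refine Finset.eq_of_subset_of_card_le ?_ ?_
  · intro z hz
    obtain ⟨i, hi, rfl⟩ := Finset.mem_image.1 hz
    exact (mem_fiber hP).2 (h2 i hi)
  · rw [Finset.card_image_of_injOn hI, hr, card_fiber hP hs]
    exact card_fiber_le P _

end Polynomial

/-! ### Lower bounds for the derivative in terms of distances to critical values -/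

namespace Polynomial

open Filter Topology Set

variable {P : ℂ[X]}

theorem norm_eval_eq_prod_roots (Q : ℂ[X]) (z : ℂ) :
    ‖Q.eval z‖ = ‖Q.leadingCoeff‖ * (Q.roots.map fun ζ => ‖z - ζ‖).prod := by
  have h := C_leadingCoeff_mul_prod_multiset_X_sub_C
    (IsAlgClosed.card_roots_eq_natDegree (p := Q))
  conv_lhs => rw [← h]
  rw [eval_mul, eval_C, norm_mul, eval_multiset_prod, Multiset.map_map]
  congr 1
  have := map_multiset_prod (normHom : ℂ →*₀ ℝ) (Q.roots.map fun ζ => z - ζ)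
  simpa [Multiset.map_map, Function.comp_def] using this

/-- A lower bound for the derivative of a monic polynomial in terms of the distance to a critical
value. -/
theorem exists_norm_eval_sub_pow_le (hP : P.Monic) (h2 : 2 ≤ P.natDegree) (z : ℂ) :
    ∃ ζ ∈ P.derivative.roots, ‖P.eval z - P.eval ζ‖ ^ (P.natDegree - 1) ≤
      2 ^ (P.natDegree - 1) ^ 2 * ‖P.derivative.eval z‖ ^ P.natDegree := by
  obtain ⟨m, hm⟩ : ∃ m, P.natDegree = m + 1 := ⟨P.natDegree - 1, by omega⟩
  have hdeg : P.derivative.natDegree = m := by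
    rw [natDegree_derivative, hm]; omega
  have hcard : P.derivative.roots.card = m := by
    rw [IsAlgClosed.card_roots_eq_natDegree, hdeg]
  have hlead : ‖P.derivative.leadingCoeff‖ = m + 1 := by
    rw [leadingCoeff, hdeg, coeff_derivative, ← hm, hP.coeff_natDegree, one_mul]
    exact_mod_cast Complex.norm_natCast (m + 1)
  have hne : P.derivative.roots.toFinset.Nonempty := by
    rw [Multiset.toFinset_nonempty]
    intro h
    rw [h] at hcard
    simp at hcard
    omega
  -- Take the critical point nearest to `z`. Then every factor of `P'(z)` is at least `d`, and along
  -- the segment from `ζ` to `z` no factor exceeds twice its size at `z`.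
  obtain ⟨ζ, hζ, hmin⟩ := P.derivative.roots.toFinset.exists_min_image (fun ζ => ‖z - ζ‖) hne
  have hζ' : ζ ∈ P.derivative.roots := by simpa using hζ
  refine ⟨ζ, hζ', ?_⟩
  rw [hm, Nat.add_sub_cancel]
  set D := ‖P.derivative.eval z‖ with hD
  set d := ‖z - ζ‖ with hd
  have hd0 : 0 ≤ d := norm_nonneg _
  have hD0 : 0 ≤ D := norm_nonneg _
  have hdD : d ^ m ≤ D := by
    have h1 : d ^ m ≤ (P.derivative.roots.map fun ζ => ‖z - ζ‖).prod := by
      rw [← hcard, ← Multiset.prod_replicate, ← Multiset.map_const']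
      refine Multiset.prod_map_le_prod_map₀ _ _ (fun _ _ => hd0) fun i hi => ?_
      exact hmin i (by simpa using hi)
    rw [hD, norm_eval_eq_prod_roots, hlead]
    have h0 : (0 : ℝ) ≤ d ^ m := by positivity
    have : (0 : ℝ) ≤ m := by positivity
    nlinarith
  have hseg : ∀ y ∈ segment ℝ ζ z, ‖P.derivative.eval y‖ ≤ 2 ^ m * D := by
    intro y hy
    have hyz : ‖y - z‖ ≤ d := by
      have := norm_sub_le_of_mem_segment (segment_symm ℝ ζ z ▸ hy)
      rwa [norm_sub_rev ζ z] at this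
    rw [hD, norm_eval_eq_prod_roots, norm_eval_eq_prod_roots, mul_left_comm]
    refine mul_le_mul_of_nonneg_left ?_ (norm_nonneg _)
    rw [← hcard, ← Multiset.prod_replicate, ← Multiset.map_const', ← Multiset.prod_map_mul]
    refine Multiset.prod_map_le_prod_map₀ _ _ (fun _ _ => norm_nonneg _) fun i hi => ?_
    have h1 : d ≤ ‖z - i‖ := hmin i (by simpa using hi)
    calc ‖y - i‖ = ‖(y - z) + (z - i)‖ := by ring_nf
      _ ≤ ‖y - z‖ + ‖z - i‖ := norm_add_le _ _
      _ ≤ 2 * ‖z - i‖ := by linarith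
  have hX : ‖P.eval z - P.eval ζ‖ ≤ 2 ^ m * D * d :=
    (convex_segment ζ z).norm_image_sub_le_of_norm_hasDerivWithin_le
      (fun y _ => (P.hasDerivAt y).hasDerivWithinAt) hseg (left_mem_segment ℝ ζ z)
      (right_mem_segment ℝ ζ z)
  calc ‖P.eval z - P.eval ζ‖ ^ m ≤ (2 ^ m * D * d) ^ m := by gcongr
    _ = 2 ^ m ^ 2 * D ^ m * d ^ m := by rw [mul_pow, mul_pow, ← pow_mul, sq]
    _ ≤ 2 ^ m ^ 2 * D ^ m * D := by gcongr
    _ = 2 ^ m ^ 2 * D ^ (m + 1) := by ring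

/-- The exponent `1 - 1 / n` that bounds the singularities of the inverse of a polynomial of
degree `n`. -/
noncomputable def branchExponent (P : ℂ[X]) : ℝ := 1 - 1 / P.natDegree

/-- The constant in the lower bound of the derivative. -/
noncomputable def branchConstant (P : ℂ[X]) : ℝ :=
  ((2 : ℝ) ^ (P.natDegree - 1) ^ 2) ^ (1 / P.natDegree : ℝ)

theorem branchConstant_nonneg (P : ℂ[X]) : 0 ≤ P.branchConstant := by
  unfold branchConstant; positivity

theorem branchExponent_nonneg (hP : 1 ≤ P.natDegree) : 0 ≤ P.branchExponent := by
  have : (1 : ℝ) ≤ P.natDegree := by exact_mod_cast hP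
  rw [branchExponent, sub_nonneg, div_le_one (by linarith)]
  exact this

theorem branchExponent_lt_one (hP : 1 ≤ P.natDegree) : P.branchExponent < 1 := by
  have : (1 : ℝ) ≤ P.natDegree := by exact_mod_cast hP
  rw [branchExponent]
  have : (0 : ℝ) < 1 / P.natDegree := by positivity
  linarith

theorem exists_norm_eval_sub_rpow_le (hP : P.Monic) (h2 : 2 ≤ P.natDegree) (z : ℂ) :
    ∃ ζ ∈ P.derivative.roots, ‖P.eval z - P.eval ζ‖ ^ P.branchExponent ≤
      P.branchConstant * ‖P.derivative.eval z‖ := by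
  obtain ⟨ζ, hζ, h⟩ := exists_norm_eval_sub_pow_le hP h2 z
  refine ⟨ζ, hζ, ?_⟩
  have hn : (0 : ℝ) < P.natDegree := by exact_mod_cast (by omega : 0 < P.natDegree)
  have h' := Real.rpow_le_rpow (by positivity) h (by positivity : (0 : ℝ) ≤ 1 / P.natDegree)
  rw [Real.mul_rpow (by positivity) (by positivity), ← Real.rpow_natCast, ← Real.rpow_mul
    (norm_nonneg _), ← Real.rpow_natCast (‖P.derivative.eval z‖), ← Real.rpow_mul (norm_nonneg _),
    mul_one_div_cancel hn.ne', Real.rpow_one, Nat.cast_sub (by omega)] at h'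
  convert h' using 2
  · rw [branchExponent]
    field_simp
    simp
  · rfl

theorem derivative_eq_one (hP : P.Monic) (h1 : P.natDegree = 1) : P.derivative = 1 := by
  rw [hP.eq_X_add_C h1]
  simp

/-- The critical point in `exists_norm_eval_sub_rpow_le` depends on `z`; summing over all of them
removes this dependence. The summand `1` serves degree one, where there are no critical points. -/
theorem inv_norm_derivative_le (hP : P.Monic) (h1 : 1 ≤ P.natDegree) {z : ℂ}
    (hz : ∀ ζ ∈ P.derivative.roots, P.eval z ≠ P.eval ζ) :
    ‖P.derivative.eval z‖⁻¹ ≤ 1 + P.branchConstant *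
      ∑ ζ ∈ P.derivative.roots.toFinset, ‖P.eval z - P.eval ζ‖ ^ (-P.branchExponent) := by
  have hK := P.branchConstant_nonneg
  have h0 : ∀ ζ ∈ P.derivative.roots.toFinset,
      0 ≤ ‖P.eval z - P.eval ζ‖ ^ (-P.branchExponent) := fun ζ _ => by positivity
  rcases h1.eq_or_lt with h1 | h1
  · rw [derivative_eq_one hP h1.symm]
    simp
  · obtain ⟨ζ, hζ, h⟩ := exists_norm_eval_sub_rpow_le hP h1 z
    have hX : 0 < ‖P.eval z - P.eval ζ‖ := norm_pos_iff.2 (sub_ne_zero.2 (hz ζ hζ))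
    have hXp : 0 < ‖P.eval z - P.eval ζ‖ ^ P.branchExponent := by positivity
    have hD : 0 < ‖P.derivative.eval z‖ := by
      by_contra! hD
      nlinarith [norm_nonneg (P.derivative.eval z)]
    have : ‖P.derivative.eval z‖⁻¹ ≤
        P.branchConstant * ‖P.eval z - P.eval ζ‖ ^ (-P.branchExponent) := by
      rw [Real.rpow_neg hX.le, inv_le_iff_one_le_mul₀ hD]
      field_simp
      linarith
    calc _ ≤ _ := this
      _ ≤ P.branchConstant *
        ∑ ζ ∈ P.derivative.roots.toFinset, ‖P.eval z - P.eval ζ‖ ^ (-P.branchExponent) := by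
        gcongr
        exact Finset.single_le_sum (f := fun ζ => ‖P.eval z - P.eval ζ‖ ^ (-P.branchExponent))
          h0 (by simpa using hζ)
      _ ≤ _ := by linarith

/-- The sum of `1 / |P'|` over the solutions of `P z = u`. -/
noncomputable def invDerivSum (P : ℂ[X]) (u : ℂ) : ℝ := ∑ z ∈ P.fiber u, ‖P.derivative.eval z‖⁻¹

theorem invDerivSum_nonneg (P : ℂ[X]) (u : ℂ) : 0 ≤ P.invDerivSum u :=
  Finset.sum_nonneg fun _ _ => by positivity

theorem invDerivSum_le (hP : P.Monic) (h1 : 1 ≤ P.natDegree) {u : ℂ}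
    (hu : ∀ ζ ∈ P.derivative.roots, u ≠ P.eval ζ) :
    P.invDerivSum u ≤ P.natDegree * (1 + P.branchConstant *
      ∑ ζ ∈ P.derivative.roots.toFinset, ‖u - P.eval ζ‖ ^ (-P.branchExponent)) := by
  have hK := P.branchConstant_nonneg
  have : ∀ z ∈ P.fiber u, ‖P.derivative.eval z‖⁻¹ ≤ 1 + P.branchConstant *
      ∑ ζ ∈ P.derivative.roots.toFinset, ‖u - P.eval ζ‖ ^ (-P.branchExponent) := by
    intro z hz
    have hz' := (mem_fiber h1).1 hz
    subst hz'
    exact inv_norm_derivative_le hP h1 hu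
  refine (Finset.sum_le_card_nsmul _ _ _ this).trans ?_
  rw [nsmul_eq_mul]
  gcongr
  exact card_fiber_le P u

/-- All critical values lie in a disc of radius `M`, so for large `u` each is at distance more than
`‖u‖ / 2`, and the lower bound for `P'` becomes a multiple of `‖u‖ ^ (1 - 1 / n)`. This makes the
normalized length bounded near `+∞`. -/
theorem exists_invDerivSum_le_of_large (hP : P.Monic) (h1 : 1 ≤ P.natDegree) :
    ∃ M C : ℝ, ∀ u : ℂ, M ≤ ‖u‖ → ‖u‖ ^ P.branchExponent * P.invDerivSum u ≤ C := by
  have hα := branchExponent_nonneg h1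
  have hK := P.branchConstant_nonneg
  obtain ⟨M, hM⟩ : ∃ M : ℝ, ∀ ζ ∈ P.derivative.roots.toFinset, ‖P.eval ζ‖ ≤ M :=
    (P.derivative.roots.toFinset.image fun ζ => ‖P.eval ζ‖).exists_le.imp
      fun M h ζ hζ => h _ (Finset.mem_image_of_mem _ hζ)
  refine ⟨2 * M + 1, P.natDegree * (1 + 2 ^ P.branchExponent * P.branchConstant), fun u hu => ?_⟩
  rw [invDerivSum, Finset.mul_sum]
  refine (Finset.sum_le_card_nsmul _ _ (1 + 2 ^ P.branchExponent * P.branchConstant) ?_).trans ?_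
  · intro z hz
    have hz' := (mem_fiber h1).1 hz
    rcases h1.eq_or_lt with h1 | h1
    · rw [derivative_eq_one hP h1.symm, branchExponent, ← h1]
      simp
      positivity
    · obtain ⟨ζ, hζ, h⟩ := exists_norm_eval_sub_rpow_le hP h1 z
      have hζM := hM ζ (by simpa using hζ)
      rw [hz'] at h
      have hX : ‖u‖ / 2 < ‖u - P.eval ζ‖ := by
        have := norm_sub_norm_le u (P.eval ζ)
        linarith
      have hu0 : 0 < ‖u‖ := by linarith [norm_nonneg (P.eval ζ)]
      have h3 : (‖u‖ / 2) ^ P.branchExponent ≤ P.branchConstant * ‖P.derivative.eval z‖ :=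
        (Real.rpow_le_rpow (by positivity) hX.le hα).trans h
      rw [Real.div_rpow hu0.le (by norm_num)] at h3
      have hup : 0 < ‖u‖ ^ P.branchExponent / 2 ^ P.branchExponent := by positivity
      have hD : 0 < ‖P.derivative.eval z‖ := by
        by_contra! hD
        nlinarith [norm_nonneg (P.derivative.eval z)]
      rw [div_le_iff₀ (by positivity)] at h3
      rw [← div_eq_mul_inv, div_le_iff₀ hD]
      linarith
  · rw [nsmul_eq_mul]
    gcongr
    exact card_fiber_le P u

end Polynomial

/-! ### Length of curves and local comparison of measures -/

open Filter Topology Set in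
/-- A curve with nonzero strict derivative changes the length of sets by about the absolute value of
the derivative. -/
theorem HasStrictDerivAt.exists_hausdorffMeasure_image {γ : ℝ → ℂ} {γ' : ℂ} {x : ℝ}
    (hγ : HasStrictDerivAt γ γ' x) (h0 : γ' ≠ 0) {c : ℝ} (hc : 1 < c) :
    ∃ U ∈ 𝓝 x, InjOn γ U ∧ ContinuousOn γ U ∧ ∀ A ⊆ U,
      Measure.hausdorffMeasure 1 (γ '' A) ≤ ENNReal.ofReal (c * ‖γ'‖) * volume A ∧
      ENNReal.ofReal ‖γ'‖ * volume A ≤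
        ENNReal.ofReal c * Measure.hausdorffMeasure 1 (γ '' A) := by
  have hm : 0 < ‖γ'‖ := norm_pos_iff.2 h0
  have hc0 : 0 < c := by linarith
  set m := ‖γ'‖
  have hci : 1 / c < 1 := by rw [div_lt_one hc0]; exact hc
  -- With this error the lower slope is exactly `m / c`, and the upper slope `m * (2 - 1 / c)` is at
  -- most `c * m`.
  have hε : 0 < m * (1 - 1 / c) := mul_pos hm (by linarith)
  have h1 := (hasStrictDerivAt_iff_hasStrictFDerivAt.1 hγ).isLittleO.def hε
  rw [nhds_prod_eq] at h1
  obtain ⟨U, hU, hUU⟩ := (eventually_prod_self_iff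
    (r := fun a b => ‖γ a - γ b - (a - b) • γ'‖ ≤ m * (1 - 1 / c) * ‖a - b‖)).1 h1
  have hup : ∀ a ∈ U, ∀ b ∈ U, ‖γ a - γ b‖ ≤ c * m * ‖a - b‖ := by
    intro a ha b hb
    have h := hUU a ha b hb
    have h2 : ‖γ a - γ b‖ ≤ ‖γ a - γ b - (a - b) • γ'‖ + ‖(a - b) • γ'‖ := by
      simpa using norm_add_le (γ a - γ b - (a - b) • γ') ((a - b) • γ')
    rw [norm_smul] at h2
    have h3 : 2 - 1 / c ≤ c := by
      rw [← sub_nonneg]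
      have : c - (2 - 1 / c) = (c - 1) ^ 2 / c := by field_simp; ring
      rw [this]; positivity
    have h4 : m * (2 - 1 / c) * ‖a - b‖ ≤ m * c * ‖a - b‖ := by gcongr
    change _ ≤ _ + ‖a - b‖ * m at h2
    linarith
  have hlow : ∀ a ∈ U, ∀ b ∈ U, m * ‖a - b‖ ≤ c * ‖γ a - γ b‖ := by
    intro a ha b hb
    have h := hUU a ha b hb
    have h2 : ‖(a - b) • γ'‖ ≤ ‖γ a - γ b - (a - b) • γ'‖ + ‖γ a - γ b‖ := by
      have := norm_sub_le (γ a - γ b) (γ a - γ b - (a - b) • γ')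
      rw [sub_sub_cancel] at this
      linarith
    rw [norm_smul] at h2
    change ‖a - b‖ * m ≤ _ at h2
    have h5 : m / c * ‖a - b‖ ≤ ‖γ a - γ b‖ := by
      have : m / c = m - m * (1 - 1 / c) := by field_simp; ring
      rw [this]; linarith
    calc m * ‖a - b‖ = c * (m / c * ‖a - b‖) := by field_simp
      _ ≤ _ := by gcongr
  have hinj : InjOn γ U := by
    intro a ha b hb hab
    have h := hlow a ha b hb
    rw [hab, sub_self, norm_zero, mul_zero] at h
    have : ‖a - b‖ ≤ 0 := by
      by_contra! h'
      nlinarith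
    simpa [sub_eq_zero] using this
  have hlip : LipschitzOnWith (c * m).toNNReal γ U := by
    refine LipschitzOnWith.of_dist_le_mul fun a ha b hb => ?_
    rw [Real.coe_toNNReal _ (by positivity), dist_eq_norm, dist_eq_norm]
    exact hup a ha b hb
  refine ⟨U, hU, hinj, hlip.continuousOn, fun A hA => ⟨?_, ?_⟩⟩
  · have := (hlip.mono hA).hausdorffMeasure_image_le zero_le_one
    simpa [hausdorffMeasure_real, ENNReal.ofReal] using this
  · have hinv : LipschitzOnWith (c / m).toNNReal (Function.invFunOn γ U) (γ '' A) := by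
      refine LipschitzOnWith.of_dist_le_mul ?_
      rintro _ ⟨a, ha, rfl⟩ _ ⟨b, hb, rfl⟩
      rw [Real.coe_toNNReal _ (by positivity), dist_eq_norm, dist_eq_norm,
        hinj.leftInvOn_invFunOn (hA ha), hinj.leftInvOn_invFunOn (hA hb)]
      have := hlow a (hA ha) b (hA hb)
      rw [div_mul_eq_mul_div, le_div_iff₀ hm]
      linarith
    have h := hinv.hausdorffMeasure_image_le zero_le_one
    have himg : Function.invFunOn γ U '' (γ '' A) = A := by
      rw [image_image]
      exact (image_congr fun a ha => hinj.leftInvOn_invFunOn (hA ha)).trans (image_id' A)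
    rw [himg, hausdorffMeasure_real, ENNReal.rpow_one] at h
    calc ENNReal.ofReal m * volume A
        ≤ ENNReal.ofReal m * (ENNReal.ofReal (c / m) * Measure.hausdorffMeasure 1 (γ '' A)) := by
          gcongr
          exact h
      _ = _ := by
          rw [← mul_assoc, ← ENNReal.ofReal_mul hm.le, mul_div_cancel₀ _ hm.ne']

open Filter Topology Set in
/-- Local domination of measures implies global domination. -/
theorem MeasureTheory.Measure.le_mul_of_locally_le {μ ν : Measure ℝ} {O : Set ℝ} {C : ENNReal}
    (h : ∀ x ∈ O, ∃ U ∈ 𝓝 x, ∀ A ⊆ U, MeasurableSet A → ν A ≤ C * μ A)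
    {A : Set ℝ} (hA : A ⊆ O) (hAm : MeasurableSet A) : ν A ≤ C * μ A := by
  choose! U hU hUA using h
  obtain ⟨t, htO, htc, hcov⟩ := TopologicalSpace.countable_cover_nhdsWithin
    (f := fun x => interior (U x)) (s := A)
    (fun x hx => mem_nhdsWithin_of_mem_nhds (interior_mem_nhds.2 (hU x (hA hx))))
  rcases t.eq_empty_or_nonempty with rfl | hne
  · have : A = ∅ := by simpa using hcov
    simp [this]
  obtain ⟨f, rfl⟩ := htc.exists_eq_range hne
  rw [biUnion_range] at hcov
  -- Disjoint pieces, each inside one good neighbourhood, allow the local inequalities to be added.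
  have hm : ∀ k, MeasurableSet (A ∩ disjointed (fun k => interior (U (f k))) k) := fun k =>
    hAm.inter (MeasurableSet.disjointed (fun k => isOpen_interior.measurableSet) k)
  have hd : Pairwise (Function.onFun Disjoint
      fun k => A ∩ disjointed (fun k => interior (U (f k))) k) := by
    intro i j hij
    exact (disjoint_disjointed _ hij).mono inter_subset_right inter_subset_right
  have hA' : A = ⋃ k, A ∩ disjointed (fun k => interior (U (f k))) k := by
    rw [← inter_iUnion, iUnion_disjointed]
    exact (inter_eq_left.2 hcov).symm
  rw [hA', measure_iUnion hd hm, measure_iUnion hd hm, ← ENNReal.tsum_mul_left]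
  refine ENNReal.tsum_le_tsum fun k => hUA (f k) (hA (htO (mem_range_self k))) _ ?_ (hm k)
  exact inter_subset_right.trans ((disjointed_subset _ _).trans interior_subset)

theorem ENNReal.le_of_forall_one_lt_le_ofReal_mul {a b : ENNReal}
    (h : ∀ c : ℝ, 1 < c → a ≤ ENNReal.ofReal c * b) : a ≤ b := by
  rcases eq_or_ne b ⊤ with rfl | hb
  · exact le_top
  have ht : Filter.Tendsto (fun c : ℝ => ENNReal.ofReal c * b) (nhdsWithin 1 (Set.Ioi 1))
      (nhds (ENNReal.ofReal 1 * b)) :=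
    ENNReal.Tendsto.mul_const ((ENNReal.continuous_ofReal.tendsto 1).mono_left nhdsWithin_le_nhds)
      (Or.inr hb)
  rw [ENNReal.ofReal_one, one_mul] at ht
  exact ge_of_tendsto ht (Filter.eventually_of_mem self_mem_nhdsWithin fun c hc => h c hc)

/-! ### The length of a level set as an integral over the argument -/

namespace Polynomial

open Filter Topology Set

variable {P : ℂ[X]}

theorem derivative_mul_deriv_branch {Z : ℂ → ℂ} {s : ℂ} (hZ : AnalyticAt ℂ Z s)
    (h : ∀ᶠ w in 𝓝 s, P.eval (Z w) = Complex.exp w) :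
    P.derivative.eval (Z s) * deriv Z s = Complex.exp s := by
  have h1 : HasDerivAt (fun w => P.eval (Z w)) (P.derivative.eval (Z s) * deriv Z s) s :=
    (P.hasDerivAt (Z s)).comp s hZ.differentiableAt.hasDerivAt
  exact h1.unique ((Complex.hasDerivAt_exp s).congr_of_eventuallyEq h)

/-- Analytic branches near a point `s` for which `exp s` is not a critical value. -/
structure IsBranchSystem (P : ℂ[X]) (s₀ : ℂ) (Z : ℂ → ℂ → ℂ) : Prop where
  analyticAt : ∀ i ∈ P.fiber (Complex.exp s₀), AnalyticAt ℂ (Z i) s₀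
  apply_self : ∀ i ∈ P.fiber (Complex.exp s₀), Z i s₀ = i
  eventually : ∀ᶠ s in 𝓝 s₀, InjOn (fun i => Z i s) (P.fiber (Complex.exp s₀)) ∧
    P.fiber (Complex.exp s) = (P.fiber (Complex.exp s₀)).image (fun i => Z i s)

theorem exists_isBranchSystem (hP : 1 ≤ P.natDegree) {s₀ : ℂ}
    (hs : ∀ z, P.eval z = Complex.exp s₀ → P.derivative.eval z ≠ 0) :
    ∃ Z, P.IsBranchSystem s₀ Z := by
  obtain ⟨Z, h1, h2⟩ := exists_branches hP hs
  exact ⟨Z, fun i hi => (h1 i hi).1, fun i hi => (h1 i hi).2, h2⟩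

namespace IsBranchSystem

variable {s₀ : ℂ} {Z : ℂ → ℂ → ℂ}

theorem sum_fiber (h : P.IsBranchSystem s₀ Z) (G : ℂ → ℝ) :
    ∀ᶠ s in 𝓝 s₀, ∑ z ∈ P.fiber (Complex.exp s), G z =
      ∑ i ∈ P.fiber (Complex.exp s₀), G (Z i s) := by
  filter_upwards [h.eventually] with s hs
  rw [hs.2, Finset.sum_image hs.1]

theorem eval_eq (hP : 1 ≤ P.natDegree) (h : P.IsBranchSystem s₀ Z) :
    ∀ i ∈ P.fiber (Complex.exp s₀), ∀ᶠ s in 𝓝 s₀, P.eval (Z i s) = Complex.exp s := by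
  intro i hi
  filter_upwards [h.eventually] with s hs
  rw [← mem_fiber hP, hs.2]
  exact Finset.mem_image_of_mem _ hi

theorem deriv_eq (hP : 1 ≤ P.natDegree) (h : P.IsBranchSystem s₀ Z) :
    ∀ i ∈ P.fiber (Complex.exp s₀), P.derivative.eval i * deriv (Z i) s₀ = Complex.exp s₀ := by
  intro i hi
  have := derivative_mul_deriv_branch (h.analyticAt i hi) (h.eval_eq hP i hi)
  rwa [h.apply_self i hi] at this

theorem norm_deriv_eq (hP : 1 ≤ P.natDegree) (h : P.IsBranchSystem s₀ Z) :
    ∀ i ∈ P.fiber (Complex.exp s₀),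
      ‖deriv (Z i) s₀‖ = Real.exp s₀.re * ‖P.derivative.eval i‖⁻¹ := by
  intro i hi
  have := h.deriv_eq hP i hi
  have h0 : ‖P.derivative.eval i‖ ≠ 0 := by
    intro h0
    rw [norm_eq_zero.1 h0, zero_mul] at this
    exact Complex.exp_ne_zero _ this.symm
  have h2 := congrArg norm this
  rw [norm_mul, Complex.norm_exp] at h2
  rw [← h2]
  field_simp

end IsBranchSystem

theorem continuousAt_invDerivSum_exp (hP : 1 ≤ P.natDegree) {s₀ : ℂ}
    (hs : ∀ z, P.eval z = Complex.exp s₀ → P.derivative.eval z ≠ 0) :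
    ContinuousAt (fun s => P.invDerivSum (Complex.exp s)) s₀ := by
  obtain ⟨Z, hZ⟩ := exists_isBranchSystem hP hs
  refine ContinuousAt.congr (f := fun s => ∑ i ∈ P.fiber (Complex.exp s₀),
    ‖P.derivative.eval (Z i s)‖⁻¹) ?_ ?_
  · refine tendsto_finsetSum _ fun i hi => ?_
    have h1 : ContinuousAt (fun s => P.derivative.eval (Z i s)) s₀ :=
      P.derivative.continuous.continuousAt.comp (hZ.analyticAt i hi).continuousAt
    refine ContinuousAt.inv₀ h1.norm ?_
    rw [hZ.apply_self i hi]
    exact norm_ne_zero_iff.2 (hs i ((mem_fiber hP).1 hi))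
  · filter_upwards [hZ.sum_fiber fun z => ‖P.derivative.eval z‖⁻¹] with s h
    exact h.symm

/-- The density of the length of the level set of `P` with respect to the argument of `P`. -/
noncomputable def lengthDensity (P : ℂ[X]) (s : ℂ) : ℝ :=
  Real.exp s.re * P.invDerivSum (Complex.exp s)

theorem lengthDensity_nonneg (P : ℂ[X]) (s : ℂ) : 0 ≤ P.lengthDensity s :=
  mul_nonneg (Real.exp_nonneg _) (invDerivSum_nonneg _ _)

theorem continuousAt_lengthDensity (hP : 1 ≤ P.natDegree) {s₀ : ℂ}
    (hs : ∀ z, P.eval z = Complex.exp s₀ → P.derivative.eval z ≠ 0) :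
    ContinuousAt P.lengthDensity s₀ :=
  (Real.continuous_exp.comp Complex.continuous_re).continuousAt.mul
    (continuousAt_invDerivSum_exp hP hs)

/-- The set of `z` with `|P z| = e ^ t`. -/
def expLevelSet (P : ℂ[X]) (t : ℝ) : Set ℂ := {z | ‖P.eval z‖ = Real.exp t}

/-- The image of the length on the level set `|P z| = e ^ t` under the argument of `P`. -/
noncomputable def levelArgMeasure (P : ℂ[X]) (t : ℝ) : Measure ℝ :=
  ((Measure.hausdorffMeasure 1).restrict (P.expLevelSet t)).map fun z => (P.eval z).arg

theorem measurable_arg_eval (P : ℂ[X]) : Measurable fun z => (P.eval z).arg :=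
  Complex.measurable_arg.comp P.continuous.measurable

theorem levelArgMeasure_apply (t : ℝ) {A : Set ℝ} (hA : MeasurableSet A) :
    P.levelArgMeasure t A =
      Measure.hausdorffMeasure 1 {z | ‖P.eval z‖ = Real.exp t ∧ (P.eval z).arg ∈ A} := by
  rw [levelArgMeasure, Measure.map_apply P.measurable_arg_eval hA, Measure.restrict_apply
    (P.measurable_arg_eval hA), inter_comm]
  rfl

theorem eval_eq_exp_iff {t θ : ℝ} (hθ : θ ∈ Ioc (-Real.pi) Real.pi) {w : ℂ} :
    w = Complex.exp (t + θ * Complex.I) ↔ ‖w‖ = Real.exp t ∧ w.arg = θ := by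
  constructor
  · rintro rfl
    refine ⟨by simp [Complex.norm_exp], ?_⟩
    rw [Complex.exp_add, ← Complex.ofReal_exp, Complex.arg_real_mul _ (Real.exp_pos t),
      Complex.exp_mul_I]
    exact Complex.arg_cos_add_sin_mul_I hθ
  · rintro ⟨h1, rfl⟩
    rw [Complex.exp_add, ← Complex.ofReal_exp, ← h1, Complex.norm_mul_exp_arg_mul_I]

/-- Over a short arc of arguments the level set is a disjoint union of `n` nearly straight curves,
one per branch, and the density is nearly constant. One factor `c` pays for the curves and the other
for the density. The open interval keeps `θ₀` off the jump of `Complex.arg`. -/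
theorem locally_comparable_levelArgMeasure (hP : 1 ≤ P.natDegree) {t θ₀ c : ℝ} (hc : 1 < c)
    (hθ : θ₀ ∈ Ioo (-Real.pi) Real.pi)
    (hs : ∀ z, P.eval z = Complex.exp (t + θ₀ * Complex.I) → P.derivative.eval z ≠ 0) :
    ∃ U ∈ 𝓝 θ₀, ∀ A ⊆ U, MeasurableSet A →
      P.levelArgMeasure t A ≤ ENNReal.ofReal (c * c) *
        ∫⁻ θ : ℝ in A, ENNReal.ofReal (P.lengthDensity (t + θ * Complex.I)) ∧
      ∫⁻ θ : ℝ in A, ENNReal.ofReal (P.lengthDensity (t + θ * Complex.I)) ≤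
        ENNReal.ofReal (c * c) * P.levelArgMeasure t A := by
  have hc0 : 0 < c := by linarith
  set s₀ : ℂ := t + θ₀ * Complex.I with hs₀
  have hre : s₀.re = t := by simp [hs₀]
  obtain ⟨Z, hZ⟩ := exists_isBranchSystem hP hs
  set r := P.fiber (Complex.exp s₀) with hr
  have hline : Continuous fun θ : ℝ => (t + θ * Complex.I : ℂ) := by fun_prop
  have hγ : ∀ i ∈ r, HasStrictDerivAt (fun θ : ℝ => Z i (t + θ * Complex.I))
      (Complex.I * deriv (Z i) s₀) θ₀ := by
    intro i hi
    have h1 : HasStrictDerivAt (fun θ : ℝ => (t + θ * Complex.I : ℂ)) Complex.I θ₀ := by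
      have := ((Complex.ofRealCLM.hasStrictDerivAt (x := θ₀)).mul_const Complex.I).const_add (t : ℂ)
      simpa using this
    exact (hZ.analyticAt i hi).hasStrictDerivAt.scomp θ₀ h1
  have hm : ∀ i ∈ r, ‖Complex.I * deriv (Z i) s₀‖ = Real.exp t * ‖P.derivative.eval i‖⁻¹ := by
    intro i hi
    rw [norm_mul, Complex.norm_I, one_mul, hZ.norm_deriv_eq hP i hi, hre]
  have hm0 : ∀ i ∈ r, Complex.I * deriv (Z i) s₀ ≠ 0 := by
    intro i hi
    rw [← norm_ne_zero_iff, hm i hi]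
    have := norm_pos_iff.2 (hs i ((mem_fiber hP).1 hi))
    positivity
  have hU := fun i (hi : i ∈ r) => (hγ i hi).exists_hausdorffMeasure_image (hm0 i hi) hc
  choose! U hUn hUinj hUcont hUA using hU
  have hD : P.lengthDensity s₀ = ∑ i ∈ r, Real.exp t * ‖P.derivative.eval i‖⁻¹ := by
    rw [lengthDensity, hre, invDerivSum, Finset.mul_sum]
  have hDpos : 0 < P.lengthDensity s₀ := by
    rw [hD]
    refine Finset.sum_pos (fun i hi => ?_) ?_
    · rw [← hm i hi]; exact norm_pos_iff.2 (hm0 i hi)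
    · rw [← Finset.card_pos, hr, card_fiber hP hs]; omega
  have hcont : Tendsto (fun θ : ℝ => P.lengthDensity (t + θ * Complex.I)) (𝓝 θ₀)
      (𝓝 (P.lengthDensity s₀)) :=
    (continuousAt_lengthDensity hP hs).tendsto.comp hline.continuousAt
  have hV : ∀ᶠ θ : ℝ in 𝓝 θ₀, θ ∈ Ioo (-Real.pi) Real.pi ∧
      (P.lengthDensity s₀ / c < P.lengthDensity (t + θ * Complex.I) ∧
      P.lengthDensity (t + θ * Complex.I) < c * P.lengthDensity s₀) ∧
      (InjOn (fun i => Z i (t + θ * Complex.I)) r ∧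
      P.fiber (Complex.exp (t + θ * Complex.I)) = r.image fun i => Z i (t + θ * Complex.I)) ∧
      ∀ i ∈ r, θ ∈ U i := by
    have hI : ∀ᶠ θ in 𝓝 θ₀, θ ∈ Ioo (-Real.pi) Real.pi := isOpen_Ioo.mem_nhds hθ
    refine hI.and (((hcont.eventually_const_lt ?_).and
      (hcont.eventually_lt_const ?_)).and
      ((hline.continuousAt.tendsto.eventually hZ.eventually).and
      ((r.eventually_all).2 fun i hi => hUn i hi)))
    · exact div_lt_self hDpos hc
    · exact lt_mul_of_one_lt_left hDpos hc
  refine ⟨_, hV, fun A hA hAm => ?_⟩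
  have hset : {z | ‖P.eval z‖ = Real.exp t ∧ (P.eval z).arg ∈ A} =
      ⋃ i ∈ r, (fun θ : ℝ => Z i (t + θ * Complex.I)) '' A := by
    ext z
    simp only [mem_ofPred_eq, mem_iUnion, mem_image, exists_prop]
    constructor
    · rintro ⟨h1, h2⟩
      have h3 := (eval_eq_exp_iff (Ioo_subset_Ioc_self (hA h2).1)).2 ⟨h1, rfl⟩
      rw [← mem_fiber hP, (hA h2).2.2.1.2, Finset.mem_image] at h3
      obtain ⟨i, hi, h⟩ := h3
      exact ⟨i, hi, _, h2, h⟩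
    · rintro ⟨i, hi, θ, hθA, rfl⟩
      have h3 : Z i (t + θ * Complex.I) ∈ P.fiber (Complex.exp (t + θ * Complex.I)) := by
        rw [(hA hθA).2.2.1.2]
        exact Finset.mem_image_of_mem _ hi
      have h4 := (eval_eq_exp_iff (Ioo_subset_Ioc_self (hA hθA).1)).1 ((mem_fiber hP).1 h3)
      exact ⟨h4.1, by rwa [h4.2]⟩
  -- The argument of `P` recovers `θ` from a point, so two curves could meet only at equal `θ`,
  -- where the branches differ.
  have hdisj : (r : Set ℂ).PairwiseDisjoint
      fun i => (fun θ : ℝ => Z i (t + θ * Complex.I)) '' A := by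
    intro i hi j hj hij
    refine Set.disjoint_left.2 ?_
    rintro _ ⟨θ, hθA, rfl⟩ ⟨θ', hθA', h⟩
    have key : ∀ k ∈ r, ∀ φ ∈ A, (P.eval (Z k (t + φ * Complex.I))).arg = φ := by
      intro k hk φ hφ
      have h3 : Z k (t + φ * Complex.I) ∈ P.fiber (Complex.exp (t + φ * Complex.I)) := by
        rw [(hA hφ).2.2.1.2]
        exact Finset.mem_image_of_mem _ hk
      exact ((eval_eq_exp_iff (Ioo_subset_Ioc_self (hA hφ).1)).1 ((mem_fiber hP).1 h3)).2
    have hθθ : θ' = θ := by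
      rw [← key i hi θ hθA, ← key j hj θ' hθA']
      exact congrArg (fun z => (P.eval z).arg) h
    subst hθθ
    exact hij ((hA hθA).2.2.1.1 hi hj h.symm)
  have hmeas : ∀ i ∈ r, MeasurableSet ((fun θ : ℝ => Z i (t + θ * Complex.I)) '' A) := by
    intro i hi
    have hAU : A ⊆ U i := fun θ h => (hA h).2.2.2 i hi
    exact hAm.image_of_continuousOn_injOn ((hUcont i hi).mono hAU) ((hUinj i hi).mono hAU)
  have hν : P.levelArgMeasure t A =
      ∑ i ∈ r, Measure.hausdorffMeasure 1 ((fun θ : ℝ => Z i (t + θ * Complex.I)) '' A) := by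
    rw [levelArgMeasure_apply t hAm, hset, measure_biUnion_finset hdisj hmeas]
  have hsum : ENNReal.ofReal (P.lengthDensity s₀) =
      ∑ i ∈ r, ENNReal.ofReal ‖Complex.I * deriv (Z i) s₀‖ := by
    rw [hD, ENNReal.ofReal_sum_of_nonneg fun i _ => by positivity]
    exact Finset.sum_congr rfl fun i hi => by rw [hm i hi]
  have hup : P.levelArgMeasure t A ≤
      ENNReal.ofReal c * (ENNReal.ofReal (P.lengthDensity s₀) * volume A) := by
    rw [hν, hsum, Finset.sum_mul, Finset.mul_sum]
    refine Finset.sum_le_sum fun i hi => ?_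
    rw [← mul_assoc, ← ENNReal.ofReal_mul hc0.le]
    exact (hUA i hi A fun θ h => (hA h).2.2.2 i hi).1
  have hlow : ENNReal.ofReal (P.lengthDensity s₀) * volume A ≤
      ENNReal.ofReal c * P.levelArgMeasure t A := by
    rw [hν, hsum, Finset.sum_mul, Finset.mul_sum]
    refine Finset.sum_le_sum fun i hi => ?_
    exact (hUA i hi A fun θ h => (hA h).2.2.2 i hi).2
  have hIup : ∫⁻ θ : ℝ in A, ENNReal.ofReal (P.lengthDensity (t + θ * Complex.I)) ≤
      ENNReal.ofReal c * (ENNReal.ofReal (P.lengthDensity s₀) * volume A) := by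
    rw [← mul_assoc, ← ENNReal.ofReal_mul hc0.le, ← setLIntegral_const]
    exact setLIntegral_mono' hAm fun θ h => ENNReal.ofReal_le_ofReal (hA h).2.1.2.le
  have hIlow : ENNReal.ofReal (P.lengthDensity s₀) * volume A ≤
      ENNReal.ofReal c * ∫⁻ θ : ℝ in A, ENNReal.ofReal (P.lengthDensity (t + θ * Complex.I)) := by
    have h1 : ENNReal.ofReal (P.lengthDensity s₀ / c) * volume A ≤
        ∫⁻ θ : ℝ in A, ENNReal.ofReal (P.lengthDensity (t + θ * Complex.I)) := by
      rw [← setLIntegral_const]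
      exact setLIntegral_mono' hAm fun θ h => ENNReal.ofReal_le_ofReal (hA h).2.1.1.le
    calc _ = ENNReal.ofReal c * (ENNReal.ofReal (P.lengthDensity s₀ / c) * volume A) := by
          rw [← mul_assoc, ← ENNReal.ofReal_mul hc0.le, mul_div_cancel₀ _ hc0.ne']
      _ ≤ _ := by gcongr
  rw [ENNReal.ofReal_mul hc0.le, mul_assoc, mul_assoc]
  exact ⟨hup.trans (by gcongr), hIup.trans (by gcongr)⟩

end Polynomial

/-! ### Integrability of the density and continuity of the length -/

theorem intervalIntegrable_abs_sin_rpow_neg {α : ℝ} (h1 : α < 1) (φ a b : ℝ) :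
    IntervalIntegrable (fun θ => |Real.sin (θ - φ)| ^ (-α)) volume a b := by
  have hm : Measurable fun x : ℝ => |Real.sin x| ^ (-α) := by fun_prop
  have hhalf : IntervalIntegrable (fun x => |Real.sin x| ^ (-α)) volume 0 (Real.pi / 2) := by
    rcases le_or_gt 0 α with h0 | h0
    · have h2 : IntervalIntegrable (fun x : ℝ => (2 / Real.pi) ^ (-α) * x ^ (-α)) volume 0
          (Real.pi / 2) :=
        (intervalIntegral.intervalIntegrable_rpow' (by linarith)).const_mul _
      refine h2.mono_fun hm.aestronglyMeasurable ?_
      rw [Set.uIoc_of_le (by positivity)]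
      -- Jordan's inequality `sin x ≥ 2 x / π` reduces the singularity to that of `x ^ (-α)`.
      filter_upwards [ae_restrict_mem measurableSet_Ioc] with x hx
      have hx0 : 0 < x := hx.1
      have h3 : 2 / Real.pi * x ≤ Real.sin x := Real.mul_le_sin hx0.le hx.2
      have h4 : 0 < 2 / Real.pi * x := by positivity
      rw [Real.norm_of_nonneg (by positivity), Real.norm_of_nonneg (by positivity),
        abs_of_pos (h4.trans_le h3), ← Real.mul_rpow (by positivity) hx0.le]
      exact Real.rpow_le_rpow_of_nonpos h4 h3 (by linarith)
    · exact (Continuous.rpow_const (by fun_prop) fun x => Or.inr (by linarith)).intervalIntegrable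
        _ _
  have hneg : IntervalIntegrable (fun x => |Real.sin x| ^ (-α)) volume (-(Real.pi / 2)) 0 := by
    rw [IntervalIntegrable.iff_comp_neg]
    simpa using hhalf.symm
  have hper : Function.Periodic (fun x => |Real.sin x| ^ (-α)) Real.pi := by
    intro x
    simp [Real.sin_add_pi]
  have hall := hper.intervalIntegrable Real.pi_pos.ne' (t := -(Real.pi / 2))
    (by convert hneg.trans hhalf using 1; ring) (a - φ) (b - φ)
  simpa using hall.comp_sub_right φ

namespace Polynomial

open Filter Topology Set

variable {P : ℂ[X]}

/-- Rotate `v` onto the positive axis and keep only the imaginary part. The bound does not involve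
`‖v‖`, hence dominates uniformly as the line `Re s = t` crosses a critical value. -/
theorem exp_mul_abs_sin_le (t θ : ℝ) (v : ℂ) :
    Real.exp t * |Real.sin (θ - v.arg)| ≤ ‖Complex.exp (t + θ * Complex.I) - v‖ := by
  have h1 : (Complex.exp (t + θ * Complex.I) - v) * Complex.exp ((-v.arg : ℝ) * Complex.I) =
      Complex.exp (t + (θ - v.arg : ℝ) * Complex.I) - ‖v‖ := by
    conv_lhs => enter [1, 2]; rw [← Complex.norm_mul_exp_arg_mul_I v]
    rw [sub_mul, mul_assoc, ← Complex.exp_add, ← Complex.exp_add]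
    push_cast
    ring_nf
    simp
  have h2 : ‖Complex.exp (t + θ * Complex.I) - v‖ =
      ‖Complex.exp (t + (θ - v.arg : ℝ) * Complex.I) - ‖v‖‖ := by
    rw [← h1, norm_mul, Complex.norm_exp_ofReal_mul_I, mul_one]
  rw [h2]
  have h3 := Complex.abs_im_le_norm (Complex.exp (t + (θ - v.arg : ℝ) * Complex.I) - ‖v‖)
  rw [Complex.sub_im, Complex.exp_im, Complex.ofReal_im, sub_zero] at h3
  simp only [Complex.add_re, Complex.add_im, Complex.ofReal_re, Complex.ofReal_im,
    Complex.mul_re, Complex.mul_im, Complex.I_re, Complex.I_im, mul_zero, mul_one, sub_zero,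
    add_zero, zero_add] at h3
  rwa [abs_mul, abs_of_pos (Real.exp_pos t)] at h3

/-- The arguments of critical values and of their negatives. -/
def criticalArgs (P : ℂ[X]) : Set ℝ :=
  ⋃ ζ ∈ P.derivative.roots.toFinset, {θ | Real.sin (θ - (P.eval ζ).arg) = 0}

theorem countable_criticalArgs (P : ℂ[X]) : P.criticalArgs.Countable := by
  refine (Finset.countable_toSet _).biUnion fun ζ _ => ?_
  refine (countable_range fun k : ℤ => (k : ℝ) * Real.pi + (P.eval ζ).arg).mono fun θ hθ => ?_
  obtain ⟨k, hk⟩ := Real.sin_eq_zero_iff.1 hθ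
  exact ⟨k, by simp [hk]⟩

theorem sin_ne_zero_of_notMem_criticalArgs {θ : ℝ} (hθ : θ ∉ P.criticalArgs) {ζ : ℂ}
    (hζ : ζ ∈ P.derivative.roots) : Real.sin (θ - (P.eval ζ).arg) ≠ 0 := fun h =>
  hθ (mem_biUnion (show ζ ∈ (P.derivative.roots.toFinset : Set ℂ) by simpa using hζ) h)

theorem exp_ne_criticalValue {θ : ℝ} (hθ : θ ∉ P.criticalArgs) (t : ℝ) {ζ : ℂ}
    (hζ : ζ ∈ P.derivative.roots) : Complex.exp (t + θ * Complex.I) ≠ P.eval ζ := by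
  intro h
  have h1 := exp_mul_abs_sin_le t θ (P.eval ζ)
  rw [h, sub_self, norm_zero] at h1
  have := abs_pos.2 (sin_ne_zero_of_notMem_criticalArgs hθ hζ)
  have := mul_pos (Real.exp_pos t) this
  linarith

theorem derivative_ne_zero_of_one_le (hP : 1 ≤ P.natDegree) : P.derivative ≠ 0 := by
  intro h
  have := derivative_eq_zero.1 h
  omega

theorem derivative_eval_ne_zero_of_notMem (hP : 1 ≤ P.natDegree) {θ : ℝ}
    (hθ : θ ∉ P.criticalArgs) (t : ℝ) (z : ℂ) (hz : P.eval z = Complex.exp (t + θ * Complex.I)) :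
    P.derivative.eval z ≠ 0 := fun h =>
  exp_ne_criticalValue hθ t ((mem_roots (derivative_ne_zero_of_one_le hP)).2 h) hz.symm

/-- Countably many arguments correspond to countably many points, because fibers are finite, and
points have no length. -/
theorem levelArgMeasure_eq_zero (hP : 1 ≤ P.natDegree) (t : ℝ) {B : Set ℝ}
    (hB : (B ∩ Ioc (-Real.pi) Real.pi).Countable) (hBm : MeasurableSet B) :
    P.levelArgMeasure t B = 0 := by
  rw [levelArgMeasure_apply t hBm]
  have hc : (⋃ b ∈ B ∩ Ioc (-Real.pi) Real.pi,
      (P.fiber (Complex.exp (t + b * Complex.I)) : Set ℂ)).Countable :=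
    hB.biUnion fun b _ => Finset.countable_toSet _
  have := Measure.nullSingletonClass_hausdorff ℂ (zero_lt_one (α := ℝ))
  refine measure_mono_null (fun z hz => ?_) (hc.measure_zero (Measure.hausdorffMeasure 1))
  have hI : (P.eval z).arg ∈ Ioc (-Real.pi) Real.pi := Complex.arg_mem_Ioc _
  exact mem_biUnion ⟨hz.2, hI⟩ ((mem_fiber hP).2 ((eval_eq_exp_iff hI).2 ⟨hz.1, rfl⟩))

/-- Discard the countably many exceptional arguments, which are null for both measures. Elsewhere
the measures agree locally up to every factor `c > 1`, hence globally, and letting `c` tend to `1`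
gives equality. -/
theorem hausdorffMeasure_expLevelSet (hP : 1 ≤ P.natDegree) (t : ℝ) :
    Measure.hausdorffMeasure 1 (P.expLevelSet t) =
      ∫⁻ θ : ℝ in Ioc (-Real.pi) Real.pi,
        ENNReal.ofReal (P.lengthDensity (t + θ * Complex.I)) := by
  set B := insert Real.pi P.criticalArgs with hB
  have hBc : B.Countable := P.countable_criticalArgs.insert _
  set O := Ioc (-Real.pi) Real.pi \ B with hO
  have hOm : MeasurableSet O := measurableSet_Ioc.diff hBc.measurableSet
  have h1 : Measure.hausdorffMeasure 1 (P.expLevelSet t) = P.levelArgMeasure t O := by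
    have h2 : Measure.hausdorffMeasure 1 (P.expLevelSet t) = P.levelArgMeasure t univ := by
      rw [levelArgMeasure_apply t MeasurableSet.univ]
      simp [expLevelSet]
    rw [h2, ← measure_add_measure_compl hOm, levelArgMeasure_eq_zero hP t _ hOm.compl, add_zero]
    refine hBc.mono fun θ hθ => ?_
    by_contra h
    exact hθ.1 ⟨hθ.2, h⟩
  have hloc : ∀ c : ℝ, 1 < c → ∀ θ ∈ O, ∃ U ∈ 𝓝 θ, ∀ A ⊆ U, MeasurableSet A →
      P.levelArgMeasure t A ≤ ENNReal.ofReal c *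
        ∫⁻ θ : ℝ in A, ENNReal.ofReal (P.lengthDensity (t + θ * Complex.I)) ∧
      ∫⁻ θ : ℝ in A, ENNReal.ofReal (P.lengthDensity (t + θ * Complex.I)) ≤
        ENNReal.ofReal c * P.levelArgMeasure t A := by
    intro c hc θ hθ
    -- The local comparison loses the square of its parameter.
    have hs : 1 < √c := by rw [Real.lt_sqrt zero_le_one]; simpa using hc
    have hθ1 : θ ∈ Ioo (-Real.pi) Real.pi :=
      ⟨hθ.1.1, lt_of_le_of_ne hθ.1.2 fun h => hθ.2 (h ▸ mem_insert _ _)⟩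
    have := locally_comparable_levelArgMeasure hP hs hθ1
      (derivative_eval_ne_zero_of_notMem hP (fun h => hθ.2 (mem_insert_of_mem _ h)) t)
    rwa [Real.mul_self_sqrt (by linarith)] at this
  set μ := (volume : Measure ℝ).withDensity
    fun θ => ENNReal.ofReal (P.lengthDensity (t + θ * Complex.I)) with hμ
  have hμA : ∀ A, MeasurableSet A → μ A =
      ∫⁻ θ : ℝ in A, ENNReal.ofReal (P.lengthDensity (t + θ * Complex.I)) := fun A hA =>
    withDensity_apply _ hA
  have h3 : P.levelArgMeasure t O = μ O := by
    refine le_antisymm (ENNReal.le_of_forall_one_lt_le_ofReal_mul fun c hc => ?_)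
      (ENNReal.le_of_forall_one_lt_le_ofReal_mul fun c hc => ?_)
    · refine Measure.le_mul_of_locally_le (fun θ hθ => ?_) subset_rfl hOm
      obtain ⟨U, hU, h⟩ := hloc c hc θ hθ
      exact ⟨U, hU, fun A hA hAm => hμA A hAm ▸ (h A hA hAm).1⟩
    · refine Measure.le_mul_of_locally_le (fun θ hθ => ?_) subset_rfl hOm
      obtain ⟨U, hU, h⟩ := hloc c hc θ hθ
      exact ⟨U, hU, fun A hA hAm => hμA A hAm ▸ (h A hA hAm).2⟩
  rw [h1, h3, hμA O hOm]
  exact setLIntegral_congr (sdiff_null_ae_eq_self (hBc.measure_zero _))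

theorem ae_notMem_criticalArgs (P : ℂ[X]) (μ : Measure ℝ) (hμ : μ ≪ volume) :
    ∀ᵐ θ ∂μ, θ ∉ P.criticalArgs :=
  hμ.ae_le (P.countable_criticalArgs.ae_notMem volume)

theorem lengthDensity_le (hP : P.Monic) (h1 : 1 ≤ P.natDegree) {θ : ℝ}
    (hθ : θ ∉ P.criticalArgs) {a b t : ℝ} (ha : a ≤ t) (hb : t ≤ b) :
    P.lengthDensity (t + θ * Complex.I) ≤ Real.exp b * (P.natDegree * (1 + P.branchConstant *
      ∑ ζ ∈ P.derivative.roots.toFinset, Real.exp a ^ (-P.branchExponent) *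
        |Real.sin (θ - (P.eval ζ).arg)| ^ (-P.branchExponent))) := by
  have hα := branchExponent_nonneg h1
  have hK := P.branchConstant_nonneg
  have hre : ((t : ℂ) + θ * Complex.I).re = t := by simp
  rw [lengthDensity, hre]
  refine mul_le_mul (Real.exp_le_exp.2 hb) ?_ (invDerivSum_nonneg _ _) (Real.exp_nonneg _)
  refine (invDerivSum_le hP h1 fun ζ hζ => exp_ne_criticalValue hθ t hζ).trans ?_
  gcongr with ζ hζ
  have hs := abs_pos.2 (sin_ne_zero_of_notMem_criticalArgs hθ (ζ := ζ) (by simpa using hζ))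
  rw [← Real.mul_rpow (Real.exp_nonneg _) hs.le]
  refine Real.rpow_le_rpow_of_nonpos (by positivity) ?_ (by linarith)
  refine le_trans ?_ (exp_mul_abs_sin_le t θ (P.eval ζ))
  gcongr

theorem intervalIntegrable_lengthDensity_bound (h1 : 1 ≤ P.natDegree) (a b c d : ℝ) :
    IntervalIntegrable (fun θ => Real.exp b * (P.natDegree * (1 + P.branchConstant *
      ∑ ζ ∈ P.derivative.roots.toFinset, Real.exp a ^ (-P.branchExponent) *
        |Real.sin (θ - (P.eval ζ).arg)| ^ (-P.branchExponent)))) volume c d := by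
  refine IntervalIntegrable.const_mul (IntervalIntegrable.const_mul
    (intervalIntegrable_const.add (IntervalIntegrable.const_mul ?_ _)) _) _
  have : (fun θ => ∑ ζ ∈ P.derivative.roots.toFinset, Real.exp a ^ (-P.branchExponent) *
        |Real.sin (θ - (P.eval ζ).arg)| ^ (-P.branchExponent)) =
      ∑ ζ ∈ P.derivative.roots.toFinset, fun θ => Real.exp a ^ (-P.branchExponent) *
        |Real.sin (θ - (P.eval ζ).arg)| ^ (-P.branchExponent) := by
    ext; simp
  rw [this]
  exact IntervalIntegrable.sum _ fun ζ _ =>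
    (intervalIntegrable_abs_sin_rpow_neg (branchExponent_lt_one h1) _ _ _).const_mul _

theorem aestronglyMeasurable_lengthDensity (h1 : 1 ≤ P.natDegree) (t : ℝ) (s : Set ℝ) :
    AEStronglyMeasurable (fun θ : ℝ => P.lengthDensity (t + θ * Complex.I))
      (volume.restrict s) := by
  have h2 : AEStronglyMeasurable (fun θ : ℝ => P.lengthDensity (t + θ * Complex.I))
      (volume.restrict P.criticalArgsᶜ) := by
    refine ContinuousOn.aestronglyMeasurable (fun θ hθ => ContinuousAt.continuousWithinAt ?_)
      P.countable_criticalArgs.measurableSet.compl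
    exact (continuousAt_lengthDensity h1
      (derivative_eval_ne_zero_of_notMem h1 hθ t)).comp (f := fun θ : ℝ => (t + θ * Complex.I : ℂ))
      (by fun_prop)
  rw [Measure.restrict_eq_self_of_ae_mem (s := P.criticalArgsᶜ) (P.ae_notMem_criticalArgs volume
    Measure.AbsolutelyContinuous.rfl)] at h2
  exact h2.restrict

theorem intervalIntegrable_lengthDensity (hP : P.Monic) (h1 : 1 ≤ P.natDegree) (t a b : ℝ) :
    IntervalIntegrable (fun θ : ℝ => P.lengthDensity (t + θ * Complex.I)) volume a b := by
  refine (intervalIntegrable_lengthDensity_bound (P := P) h1 t t a b).mono_fun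
    (aestronglyMeasurable_lengthDensity h1 t _) ?_
  filter_upwards [P.ae_notMem_criticalArgs _ Measure.absolutelyContinuous_restrict] with θ hθ
  have h := lengthDensity_le hP h1 hθ (le_refl t) (le_refl t)
  rw [Real.norm_of_nonneg (lengthDensity_nonneg _ _)]
  exact h.trans (le_abs_self _)

/-- Dominated convergence with the sine bound for `t` in a unit neighbourhood. For every `θ` outside
a countable set independent of `t`, the horizontal line at height `θ` meets no critical value, so
levels containing critical points need no separate treatment. -/
theorem continuous_integral_lengthDensity (hP : P.Monic) (h1 : 1 ≤ P.natDegree) :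
    Continuous fun t : ℝ => ∫ θ in (-Real.pi)..Real.pi, P.lengthDensity (t + θ * Complex.I) := by
  rw [continuous_iff_continuousAt]
  intro t₀
  refine intervalIntegral.continuousAt_of_dominated_interval (F := fun (t θ : ℝ) =>
    P.lengthDensity (t + θ * Complex.I)) (.of_forall fun t =>
    aestronglyMeasurable_lengthDensity h1 t _) ?_
    (intervalIntegrable_lengthDensity_bound (P := P) h1 (t₀ - 1) (t₀ + 1) _ _) ?_
  · filter_upwards [Icc_mem_nhds (sub_one_lt t₀) (lt_add_one t₀)] with t ht
    filter_upwards [P.ae_notMem_criticalArgs volume Measure.AbsolutelyContinuous.rfl] with θ hθ _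
    rw [Real.norm_of_nonneg (lengthDensity_nonneg _ _)]
    exact lengthDensity_le hP h1 hθ ht.1 ht.2
  · filter_upwards [P.ae_notMem_criticalArgs volume Measure.AbsolutelyContinuous.rfl] with θ hθ _
    exact (continuousAt_lengthDensity h1
      (derivative_eval_ne_zero_of_notMem h1 hθ t₀)).comp (f := fun t : ℝ => (t + θ * Complex.I : ℂ))
      (by fun_prop)

theorem hausdorffMeasure_expLevelSet_lt_top (hP : P.Monic) (h1 : 1 ≤ P.natDegree) (t : ℝ) :
    Measure.hausdorffMeasure 1 (P.expLevelSet t) < ⊤ := by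
  rw [hausdorffMeasure_expLevelSet h1]
  have := (intervalIntegrable_lengthDensity hP h1 t (-Real.pi) Real.pi).1
  exact Integrable.lintegral_lt_top this

theorem toReal_hausdorffMeasure_expLevelSet (h1 : 1 ≤ P.natDegree) (t : ℝ) :
    (Measure.hausdorffMeasure 1 (P.expLevelSet t)).toReal =
      ∫ θ in (-Real.pi)..Real.pi, P.lengthDensity (t + θ * Complex.I) := by
  rw [hausdorffMeasure_expLevelSet h1, intervalIntegral.integral_of_le (by linarith [Real.pi_pos]),
    integral_eq_lintegral_of_nonneg_ae (.of_forall fun θ => lengthDensity_nonneg _ _)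
      (aestronglyMeasurable_lengthDensity h1 t _)]

end Polynomial

/-! ### Laplacians and integrals over vertical periods -/

open Set Filter Topology

/-- The derivative of a function on the complex plane in the direction `v`. -/
noncomputable def dirDeriv (v : ℂ) (Φ : ℂ → ℝ) : ℂ → ℝ := fun s => fderiv ℝ Φ s v

/-- The Laplacian of a function on the complex plane. -/
noncomputable def planeLaplacian (Φ : ℂ → ℝ) : ℂ → ℝ := fun s =>
  dirDeriv 1 (dirDeriv 1 Φ) s + dirDeriv Complex.I (dirDeriv Complex.I Φ) s

theorem ContDiffOn.dirDeriv {Φ : ℂ → ℝ} {H : Set ℂ} (hH : IsOpen H) (h : ContDiffOn ℝ ∞ Φ H)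
    (v : ℂ) : ContDiffOn ℝ ∞ (dirDeriv v Φ) H :=
  (h.fderiv_of_isOpen hH (m := ∞) (by simp)).clm_apply contDiffOn_const

theorem Function.Periodic.dirDeriv {Φ : ℂ → ℝ} {c : ℂ} (h : Function.Periodic Φ c) (v : ℂ) :
    Function.Periodic (dirDeriv v Φ) c := by
  intro s
  unfold _root_.dirDeriv
  rw [← fderiv_comp_add_right]
  congr 3
  ext w
  exact h w

theorem Function.Periodic.planeLaplacian {Φ : ℂ → ℝ} {c : ℂ} (h : Function.Periodic Φ c) :
    Function.Periodic (planeLaplacian Φ) c := fun s =>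
  congrArg₂ (· + ·) ((h.dirDeriv 1).dirDeriv 1 s)
    ((h.dirDeriv Complex.I).dirDeriv Complex.I s)

theorem ContDiffOn.planeLaplacian {Φ : ℂ → ℝ} {H : Set ℂ} (hH : IsOpen H)
    (h : ContDiffOn ℝ ∞ Φ H) : ContDiffOn ℝ ∞ (planeLaplacian Φ) H :=
  ((h.dirDeriv hH 1).dirDeriv hH 1).add ((h.dirDeriv hH Complex.I).dirDeriv hH Complex.I)

/-- The integral of a function over a vertical segment of length `2 * π`. -/
noncomputable def verticalIntegral (Φ : ℂ → ℝ) (t : ℝ) : ℝ :=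
  ∫ θ in (-Real.pi)..Real.pi, Φ (t + θ * Complex.I)

section verticalIntegral

variable {J : Set ℝ} {Φ : ℂ → ℝ}

theorem ContinuousOn.continuous_vertical (h : ContinuousOn Φ (Complex.re ⁻¹' J)) {t : ℝ}
    (ht : t ∈ J) : Continuous fun θ : ℝ => Φ (t + θ * Complex.I) :=
  h.comp_continuous (by fun_prop) fun θ => by simpa using ht

theorem hasDerivAt_horizontal (hJ : IsOpen J) (h : ContDiffOn ℝ ∞ Φ (Complex.re ⁻¹' J)) {t : ℝ}
    (ht : t ∈ J) (θ : ℝ) :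
    HasDerivAt (fun t : ℝ => Φ (t + θ * Complex.I)) (dirDeriv 1 Φ (t + θ * Complex.I)) t := by
  have hmem : (t + θ * Complex.I : ℂ) ∈ Complex.re ⁻¹' J := by simpa using ht
  have hd := (h.contDiffAt ((hJ.preimage Complex.continuous_re).mem_nhds hmem)).differentiableAt
    (by simp)
  have hl : HasDerivAt (fun t : ℝ => (t + θ * Complex.I : ℂ)) 1 t := by
    simpa using (Complex.ofRealCLM.hasDerivAt (x := t)).add_const (θ * Complex.I)
  exact hd.hasFDerivAt.comp_hasDerivAt t hl

theorem hasDerivAt_vertical (hJ : IsOpen J) (h : ContDiffOn ℝ ∞ Φ (Complex.re ⁻¹' J)) {t : ℝ}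
    (ht : t ∈ J) (θ : ℝ) :
    HasDerivAt (fun θ : ℝ => Φ (t + θ * Complex.I)) (dirDeriv Complex.I Φ (t + θ * Complex.I))
      θ := by
  have hmem : (t + θ * Complex.I : ℂ) ∈ Complex.re ⁻¹' J := by simpa using ht
  have hd := (h.contDiffAt ((hJ.preimage Complex.continuous_re).mem_nhds hmem)).differentiableAt
    (by simp)
  have hl : HasDerivAt (fun θ : ℝ => (t + θ * Complex.I : ℂ)) Complex.I θ := by
    simpa using ((Complex.ofRealCLM.hasDerivAt (x := θ)).mul_const Complex.I).const_add (t : ℂ)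
  exact hd.hasFDerivAt.comp_hasDerivAt θ hl

/-- Differentiation under the integral sign; the derivative is bounded on a compact rectangle around
the segment. -/
theorem hasDerivAt_verticalIntegral (hJ : IsOpen J) (h : ContDiffOn ℝ ∞ Φ (Complex.re ⁻¹' J))
    {t : ℝ} (ht : t ∈ J) :
    HasDerivAt (verticalIntegral Φ) (verticalIntegral (dirDeriv 1 Φ) t) t := by
  have hH := hJ.preimage Complex.continuous_re
  have hD := (h.dirDeriv hH 1).continuousOn
  obtain ⟨ε, hε, hball⟩ := Metric.nhds_basis_closedBall.mem_iff.1 (hJ.mem_nhds ht)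
  have hK : IsCompact ((fun p : ℝ × ℝ => (p.1 + p.2 * Complex.I : ℂ)) ''
      (Metric.closedBall t ε ×ˢ Icc (-Real.pi) Real.pi)) :=
    ((isCompact_closedBall t ε).prod isCompact_Icc).image (by fun_prop)
  obtain ⟨C, hC⟩ := hK.exists_bound_of_continuousOn (hD.mono (by
    rintro _ ⟨p, hp, rfl⟩
    simpa using hball hp.1))
  refine (intervalIntegral.hasDerivAt_integral_of_dominated_loc_of_deriv_le
    (F := fun (t θ : ℝ) => Φ (t + θ * Complex.I))
    (F' := fun (t θ : ℝ) => dirDeriv 1 Φ (t + θ * Complex.I)) (bound := fun _ => C)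
    (Metric.closedBall_mem_nhds t hε) ?_ ?_ ?_ ?_ ?_ ?_).2
  · filter_upwards [hJ.mem_nhds ht] with t' ht'
    exact (h.continuousOn.continuous_vertical ht').aestronglyMeasurable
  · exact (h.continuousOn.continuous_vertical ht).intervalIntegrable _ _
  · exact (hD.continuous_vertical ht).aestronglyMeasurable
  · refine .of_forall fun θ hθ t' ht' => hC _ ⟨(t', θ), ⟨ht', ?_⟩, rfl⟩
    rw [uIoc_of_le (by linarith [Real.pi_pos])] at hθ
    exact Ioc_subset_Icc_self hθ
  · exact intervalIntegrable_const
  · exact .of_forall fun θ _ t' ht' => hasDerivAt_horizontal hJ h (hball ht') θ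

/-- The integral of a derivative over a full period vanishes. -/
theorem verticalIntegral_dirDeriv_I (hJ : IsOpen J) (h : ContDiffOn ℝ ∞ Φ (Complex.re ⁻¹' J))
    (hper : Function.Periodic Φ (2 * Real.pi * Complex.I)) {t : ℝ} (ht : t ∈ J) :
    verticalIntegral (dirDeriv Complex.I Φ) t = 0 := by
  have hD := (h.dirDeriv (hJ.preimage Complex.continuous_re) Complex.I).continuousOn
  rw [verticalIntegral, intervalIntegral.integral_eq_sub_of_hasDerivAt
    (fun θ _ => hasDerivAt_vertical hJ h ht θ)
    ((hD.continuous_vertical ht).intervalIntegrable _ _), sub_eq_zero,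
    ← hper (t + (-Real.pi : ℝ) * Complex.I)]
  congr 1
  push_cast
  ring

theorem verticalIntegral_planeLaplacian (hJ : IsOpen J)
    (h : ContDiffOn ℝ ∞ Φ (Complex.re ⁻¹' J))
    (hper : Function.Periodic Φ (2 * Real.pi * Complex.I)) {t : ℝ} (ht : t ∈ J) :
    verticalIntegral (planeLaplacian Φ) t = verticalIntegral (dirDeriv 1 (dirDeriv 1 Φ)) t := by
  have hH := hJ.preimage Complex.continuous_re
  have h1 := ((h.dirDeriv hH 1).dirDeriv hH 1).continuousOn
  have h2 := ((h.dirDeriv hH Complex.I).dirDeriv hH Complex.I).continuousOn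
  have h3 : verticalIntegral (dirDeriv Complex.I (dirDeriv Complex.I Φ)) t = 0 :=
    verticalIntegral_dirDeriv_I hJ (h.dirDeriv hH Complex.I) (hper.dirDeriv Complex.I) ht
  unfold verticalIntegral at h3 ⊢
  unfold planeLaplacian
  rw [intervalIntegral.integral_add ((h1.continuous_vertical ht).intervalIntegrable _ _)
    ((h2.continuous_vertical ht).intervalIntegrable _ _), h3, add_zero]

end verticalIntegral

/-! ### Sums of squared moduli of analytic functions -/

/-- `Φ` is near `s` a finite sum of squares of absolute values of analytic functions. -/
def IsSumNormSqAt (Φ : ℂ → ℝ) (s : ℂ) : Prop :=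
  ∃ (r : Finset ℂ) (h : ℂ → ℂ → ℂ), (∀ i ∈ r, AnalyticAt ℂ (h i) s) ∧
    Φ =ᶠ[𝓝 s] fun w => ∑ i ∈ r, ‖h i w‖ ^ 2

theorem IsSumNormSqAt.nonneg {Φ : ℂ → ℝ} {s : ℂ} (h : IsSumNormSqAt Φ s) : 0 ≤ Φ s := by
  obtain ⟨r, h, _, h2⟩ := h
  rw [h2.self_of_nhds]
  positivity

theorem IsSumNormSqAt.contDiffAt {Φ : ℂ → ℝ} {s : ℂ} (h : IsSumNormSqAt Φ s) :
    ContDiffAt ℝ ∞ Φ s := by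
  obtain ⟨r, h, h1, h2⟩ := h
  refine ContDiffAt.congr_of_eventuallyEq (ContDiffAt.sum fun i hi => ?_) h2
  exact ((h1 i hi).contDiffAt.restrict_scalars ℝ).norm_sq ℝ

theorem fderiv_real_apply_of_differentiableAt {h : ℂ → ℂ} {w : ℂ} (hw : DifferentiableAt ℂ h w)
    (v : ℂ) : fderiv ℝ h w v = v * deriv h w := by
  rw [(hw.hasDerivAt.hasFDerivAt.restrictScalars ℝ).fderiv]
  simp

theorem dirDeriv_sum_norm_sq {r : Finset ℂ} {h : ℂ → ℂ → ℂ} {w : ℂ}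
    (hw : ∀ i ∈ r, AnalyticAt ℂ (h i) w) (v : ℂ) :
    dirDeriv v (fun w => ∑ i ∈ r, ‖h i w‖ ^ 2) w =
      ∑ i ∈ r, 2 * inner ℝ (h i w) (v * deriv (h i) w) := by
  have hd : ∀ i ∈ r, DifferentiableAt ℝ (h i) w := fun i hi =>
    (hw i hi).differentiableAt.restrictScalars ℝ
  unfold dirDeriv
  rw [fderiv_fun_sum fun i hi => (hd i hi).norm_sq ℝ, _root_.sum_apply]
  refine Finset.sum_congr rfl fun i hi => ?_
  simp_rw [← real_inner_self_eq_norm_sq]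
  rw [fderiv_inner_apply ℝ (hd i hi) (hd i hi),
    fderiv_real_apply_of_differentiableAt (hw i hi).differentiableAt, real_inner_comm, two_mul]

theorem dirDeriv_dirDeriv_sum_norm_sq {r : Finset ℂ} {h : ℂ → ℂ → ℂ} {w : ℂ}
    (hw : ∀ i ∈ r, AnalyticAt ℂ (h i) w) (v : ℂ) :
    dirDeriv v (dirDeriv v (fun w => ∑ i ∈ r, ‖h i w‖ ^ 2)) w =
      ∑ i ∈ r, 2 * (inner ℝ (h i w) (v * (v * deriv (deriv (h i)) w)) +
        ‖v * deriv (h i) w‖ ^ 2) := by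
  have hev : dirDeriv v (fun w => ∑ i ∈ r, ‖h i w‖ ^ 2) =ᶠ[𝓝 w]
      fun w => ∑ i ∈ r, 2 * inner ℝ (h i w) (v * deriv (h i) w) := by
    filter_upwards [(r.eventually_all).2 fun i hi => (hw i hi).eventually_analyticAt] with w' hw'
    exact dirDeriv_sum_norm_sq hw' v
  have hd : ∀ i ∈ r, DifferentiableAt ℝ (h i) w := fun i hi =>
    (hw i hi).differentiableAt.restrictScalars ℝ
  have hd' : ∀ i ∈ r, DifferentiableAt ℂ (fun w => v * deriv (h i) w) w := fun i hi =>
    (hw i hi).deriv.differentiableAt.const_mul v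
  have hd'' : ∀ i ∈ r, DifferentiableAt ℝ (fun w => v * deriv (h i) w) w := fun i hi =>
    (hd' i hi).restrictScalars ℝ
  change fderiv ℝ (dirDeriv v fun w => ∑ i ∈ r, ‖h i w‖ ^ 2) w v = _
  rw [hev.fderiv_eq, fderiv_fun_sum fun i hi => ((hd i hi).inner ℝ (hd'' i hi)).const_mul 2,
    _root_.sum_apply]
  refine Finset.sum_congr rfl fun i hi => ?_
  rw [fderiv_const_mul ((hd i hi).inner ℝ (hd'' i hi)), _root_.smul_apply,
    fderiv_inner_apply ℝ (hd i hi) (hd'' i hi),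
    fderiv_real_apply_of_differentiableAt (hw i hi).differentiableAt,
    fderiv_real_apply_of_differentiableAt (hd' i hi), real_inner_self_eq_norm_sq,
    deriv_const_mul _ (hw i hi).deriv.differentiableAt]
  rfl

/-- The terms with the second derivative of `h i` cancel between the directions `1` and `I` because
`I ^ 2 = -1`; each direction leaves `2 * ‖(h i)'‖ ^ 2`. -/
theorem planeLaplacian_sum_norm_sq {r : Finset ℂ} {h : ℂ → ℂ → ℂ} {w : ℂ}
    (hw : ∀ i ∈ r, AnalyticAt ℂ (h i) w) :
    planeLaplacian (fun w => ∑ i ∈ r, ‖h i w‖ ^ 2) w = ∑ i ∈ r, ‖2 * deriv (h i) w‖ ^ 2 := by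
  rw [planeLaplacian, dirDeriv_dirDeriv_sum_norm_sq hw, dirDeriv_dirDeriv_sum_norm_sq hw,
    ← Finset.sum_add_distrib]
  refine Finset.sum_congr rfl fun i _ => ?_
  rw [← mul_assoc Complex.I, Complex.I_mul_I]
  simp only [one_mul, neg_mul, inner_neg_right, norm_mul, Complex.norm_I, Complex.norm_ofNat]
  ring

theorem IsSumNormSqAt.planeLaplacian {Φ : ℂ → ℝ} {s : ℂ} (h : IsSumNormSqAt Φ s) :
    IsSumNormSqAt (planeLaplacian Φ) s := by
  obtain ⟨r, h, h1, h2⟩ := h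
  refine ⟨r, fun i w => 2 * deriv (h i) w, fun i hi => analyticAt_const.mul (h1 i hi).deriv, ?_⟩
  have h3 : ∀ v, ∀ {Φ Ψ : ℂ → ℝ}, Φ =ᶠ[𝓝 s] Ψ → dirDeriv v Φ =ᶠ[𝓝 s] dirDeriv v Ψ := by
    intro v Φ Ψ h
    filter_upwards [h.fderiv (𝕜 := ℝ)] with w hw
    rw [dirDeriv, dirDeriv, hw]
  filter_upwards [h3 1 (h3 1 h2), h3 Complex.I (h3 Complex.I h2),
    (r.eventually_all).2 fun i hi => (h1 i hi).eventually_analyticAt] with w hw1 hw2 hw3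
  rw [← planeLaplacian_sum_norm_sq hw3, _root_.planeLaplacian, hw1, hw2]
  rfl

/-! ### Signs of derivatives and complete monotonicity -/

theorem add_mul_sub_le_of_hasDerivAt_of_le {f f' : ℝ → ℝ} {t₀ c : ℝ}
    (hf : ∀ t, t₀ ≤ t → HasDerivAt f (f' t) t) (hc : ∀ t, t₀ ≤ t → c ≤ f' t) {t : ℝ}
    (ht : t₀ ≤ t) : f t₀ + c * (t - t₀) ≤ f t := by
  have := (convex_Ici t₀).mul_sub_le_image_sub_of_le_deriv
    (fun x hx => (hf x hx).continuousAt.continuousWithinAt)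
    (fun x hx => (hf x (interior_subset hx)).differentiableAt.differentiableWithinAt) (C := c)
    (fun x hx => (hf x (interior_subset hx)).deriv ▸ hc x (interior_subset hx)) t₀ self_mem_Ici t
    ht ht
  linarith

/-- If the derivatives of even order are nonnegative and the function is bounded above, then
the derivatives of odd order are nonpositive. -/
theorem odd_derivatives_nonpos {J : Set ℝ} (hJ : IsUpperSet J) {A B : ℕ → ℝ → ℝ}
    (hA : ∀ k, ∀ t ∈ J, HasDerivAt (A k) (B k t) t)
    (hB : ∀ k, ∀ t ∈ J, HasDerivAt (B k) (A (k + 1) t) t) (h0 : ∀ k, ∀ t ∈ J, 0 ≤ A k t)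
    {M C : ℝ} (hC : ∀ t ∈ J, M ≤ t → A 0 t ≤ C) (k : ℕ) : ∀ t ∈ J, B k t ≤ 0 := by
  have hmono : ∀ k, ∀ t₀ ∈ J, ∀ t, t₀ ≤ t → B k t₀ ≤ B k t := by
    intro k t₀ ht₀ t ht
    have := add_mul_sub_le_of_hasDerivAt_of_le (fun t ht => hB k t (hJ ht ht₀))
      (fun t ht => h0 (k + 1) t (hJ ht ht₀)) ht
    linarith
  have hgrow : ∀ k, ∀ t₀ ∈ J, ∀ t, t₀ ≤ t → B k t₀ * (t - t₀) ≤ A k t := by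
    intro k t₀ ht₀ t ht
    have := add_mul_sub_le_of_hasDerivAt_of_le (fun t ht => hA k t (hJ ht ht₀))
      (hmono k t₀ ht₀) ht
    linarith [h0 k t₀ ht₀]
  induction k with
  | zero =>
    intro t₀ ht₀
    by_contra! hb
    -- Beyond this point the linear lower bound for `A 0` is at least `C + 1`.
    set t := max M (t₀ + (C + 1) / B 0 t₀) ⊔ t₀ with ht
    have h1 : t₀ ≤ t := le_max_right _ _
    have h2 : t₀ + (C + 1) / B 0 t₀ ≤ t := (le_max_right _ _).trans (le_max_left _ _)
    have h3 := hgrow 0 t₀ ht₀ t h1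
    have h4 := hC t (hJ h1 ht₀) ((le_max_left _ _).trans (le_max_left _ _))
    have h5 : (C + 1) / B 0 t₀ ≤ t - t₀ := by linarith
    rw [div_le_iff₀ hb] at h5
    linarith
  | succ k ih =>
    intro t₀ ht₀
    by_contra! hb
    have h1J : t₀ + 1 ∈ J := hJ (by linarith) ht₀
    -- A positive `B (k + 1) t₀` makes `A (k + 1)`, the derivative of `B k`, bounded below by a
    -- positive constant after one unit of time. Then `B k` reaches `1`, against the induction
    -- hypothesis.
    have h1 : ∀ t, t₀ + 1 ≤ t → B (k + 1) t₀ ≤ A (k + 1) t := by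
      intro t ht
      have := hgrow (k + 1) t₀ ht₀ t (by linarith)
      nlinarith
    set t := max (t₀ + 1) (t₀ + 1 + (1 - B k (t₀ + 1)) / B (k + 1) t₀)
    have ht : t₀ + 1 ≤ t := le_max_left _ _
    have h2 := add_mul_sub_le_of_hasDerivAt_of_le (fun t ht => hB k t (hJ ht h1J)) h1 ht
    have h3 : (1 - B k (t₀ + 1)) / B (k + 1) t₀ ≤ t - (t₀ + 1) := by
      have : t₀ + 1 + (1 - B k (t₀ + 1)) / B (k + 1) t₀ ≤ t := le_max_right _ _
      linarith
    rw [div_le_iff₀ hb] at h3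
    have := ih t (hJ ht h1J)
    linarith

theorem iteratedDeriv_eq_of_hasDerivAt {J : Set ℝ} (hJ : IsOpen J) {G : ℕ → ℝ → ℝ}
    (hG : ∀ k, ∀ t ∈ J, HasDerivAt (G k) (G (k + 1) t) t) (k : ℕ) :
    ∀ t ∈ J, iteratedDeriv k (G 0) t = G k t := by
  induction k with
  | zero => simp
  | succ k ih =>
    intro t ht
    rw [iteratedDeriv_succ]
    have : iteratedDeriv k (G 0) =ᶠ[𝓝 t] G k := eventually_of_mem (hJ.mem_nhds ht) ih
    rw [this.deriv_eq, (hG k t ht).deriv]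

theorem contDiffOn_of_hasDerivAt {J : Set ℝ} (hJ : IsOpen J) {G : ℕ → ℝ → ℝ}
    (hG : ∀ k, ∀ t ∈ J, HasDerivAt (G k) (G (k + 1) t) t) : ContDiffOn ℝ ∞ (G 0) J := by
  refine contDiffOn_of_differentiableOn_deriv fun m _ => ?_
  refine DifferentiableOn.congr (f := G m)
    (fun t ht => (hG m t ht).differentiableAt.differentiableWithinAt) fun t ht => ?_
  rw [iteratedDerivWithin_of_isOpen hJ ht, iteratedDeriv_eq_of_hasDerivAt hJ hG m t ht]

theorem completelyMonotone_of_hasDerivAt {J : Set ℝ} (hJo : IsOpen J) (hJ : IsUpperSet J)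
    {A B : ℕ → ℝ → ℝ} (hA : ∀ k, ∀ t ∈ J, HasDerivAt (A k) (B k t) t)
    (hB : ∀ k, ∀ t ∈ J, HasDerivAt (B k) (A (k + 1) t) t) (h0 : ∀ k, ∀ t ∈ J, 0 ≤ A k t)
    {M C : ℝ} (hC : ∀ t ∈ J, M ≤ t → A 0 t ≤ C) :
    ContDiffOn ℝ ∞ (A 0) J ∧ ∀ k, ∀ t ∈ J, 0 ≤ (-1) ^ k * iteratedDeriv k (A 0) t := by
  -- `G` interleaves `A` and `B` into the sequence of successive derivatives.
  set G : ℕ → ℝ → ℝ := fun k => if Even k then A (k / 2) else B (k / 2) with hGdef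
  have hG0 : G 0 = A 0 := by simp [hGdef]
  have hGe : ∀ k, G (k + k) = A k := fun k => by
    simp only [hGdef]; rw [if_pos ⟨k, rfl⟩]; congr 1; omega
  have hGo : ∀ k, G (2 * k + 1) = B k := fun k => by
    have : ¬ Even (2 * k + 1) := by simp
    simp only [hGdef]; rw [if_neg this]; congr 1; omega
  have hG : ∀ k, ∀ t ∈ J, HasDerivAt (G k) (G (k + 1) t) t := by
    intro k t ht
    rcases k.even_or_odd with ⟨m, rfl⟩ | ⟨m, rfl⟩
    · rw [hGe, ← two_mul, hGo]
      exact hA m t ht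
    · rw [hGo, show 2 * m + 1 + 1 = (m + 1) + (m + 1) by ring, hGe]
      exact hB m t ht
  rw [← hG0]
  refine ⟨contDiffOn_of_hasDerivAt hJo hG, fun k t ht => ?_⟩
  rw [iteratedDeriv_eq_of_hasDerivAt hJo hG k t ht]
  rcases k.even_or_odd with ⟨m, rfl⟩ | ⟨m, rfl⟩
  · rw [hGe, Even.neg_one_pow ⟨m, rfl⟩, one_mul]
    exact h0 m t ht
  · rw [hGo, Odd.neg_one_pow ⟨m, rfl⟩, neg_one_mul, neg_nonneg]
    exact odd_derivatives_nonpos hJ hA hB h0 hC m t ht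

/-- Vertical integrals of a periodic function that is locally a sum of squares of absolute values of
analytic functions are completely monotonic if they are bounded above. -/
theorem verticalIntegral_completelyMonotone {J : Set ℝ} (hJo : IsOpen J) (hJ : IsUpperSet J)
    {Φ : ℂ → ℝ} (hΦ : ∀ s ∈ Complex.re ⁻¹' J, IsSumNormSqAt Φ s)
    (hper : Function.Periodic Φ (2 * Real.pi * Complex.I)) {M C : ℝ}
    (hC : ∀ t ∈ J, M ≤ t → verticalIntegral Φ t ≤ C) :
    ContDiffOn ℝ ∞ (verticalIntegral Φ) J ∧
      ∀ k, ∀ t ∈ J, 0 ≤ (-1) ^ k * iteratedDeriv k (verticalIntegral Φ) t := by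
  have hH := hJo.preimage Complex.continuous_re
  have hS : ∀ k, ∀ s ∈ Complex.re ⁻¹' J, IsSumNormSqAt (planeLaplacian^[k] Φ) s := by
    intro k
    induction k with
    | zero => exact hΦ
    | succ k ih =>
      intro s hs
      rw [Function.iterate_succ_apply']
      exact (ih s hs).planeLaplacian
  have hP : ∀ k, Function.Periodic (planeLaplacian^[k] Φ) (2 * Real.pi * Complex.I) := by
    intro k
    induction k with
    | zero => exact hper
    | succ k ih =>
      rw [Function.iterate_succ_apply']
      exact ih.planeLaplacian
  have hD : ∀ k, ContDiffOn ℝ ∞ (planeLaplacian^[k] Φ) (Complex.re ⁻¹' J) := fun k s hs =>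
    (hS k s hs).contDiffAt.contDiffWithinAt
  refine completelyMonotone_of_hasDerivAt hJo hJ
    (A := fun k => verticalIntegral (planeLaplacian^[k] Φ))
    (B := fun k => verticalIntegral (dirDeriv 1 (planeLaplacian^[k] Φ))) (fun k t ht =>
    hasDerivAt_verticalIntegral hJo (hD k) ht) (fun k t ht => ?_) (fun k t ht => ?_) hC
  · rw [Function.iterate_succ_apply', verticalIntegral_planeLaplacian hJo (hD k) (hP k) ht]
    exact hasDerivAt_verticalIntegral hJo ((hD k).dirDeriv hH 1) ht
  · exact intervalIntegral.integral_nonneg (by linarith [Real.pi_pos]) fun θ _ =>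
      (hS k _ (by simpa using ht)).nonneg

/-- The absolute value of an analytic function without zeros is locally the square of the absolute
value of an analytic function. -/
theorem AnalyticAt.exists_norm_eq_norm_sq {g : ℂ → ℂ} {s : ℂ} (hg : AnalyticAt ℂ g s)
    (h0 : g s ≠ 0) : ∃ h : ℂ → ℂ, AnalyticAt ℂ h s ∧ ∀ᶠ w in 𝓝 s, ‖g w‖ = ‖h w‖ ^ 2 := by
  have hq : AnalyticAt ℂ (fun w => g w / g s) s := hg.div analyticAt_const h0
  have hs : g s / g s ∈ Complex.slitPlane := by rw [div_self h0]; exact Complex.one_mem_slitPlane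
  -- Division by `g s` brings the values near `1`, where the principal logarithm is analytic; the
  -- constant factor restores the modulus.
  refine ⟨fun w => (√‖g s‖ : ℝ) * Complex.exp (Complex.log (g w / g s) / 2),
    analyticAt_const.mul ((hq.clog hs).div analyticAt_const two_ne_zero).cexp, ?_⟩
  filter_upwards [hg.continuousAt.eventually_ne h0] with w hw
  have h1 : ‖Complex.exp (Complex.log (g w / g s) / 2)‖ ^ 2 = ‖g w‖ / ‖g s‖ := by
    rw [← norm_pow, ← Complex.exp_nat_mul, Nat.cast_ofNat, mul_div_cancel₀ _ two_ne_zero,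
      Complex.exp_log (div_ne_zero hw h0), norm_div]
  rw [norm_mul, mul_pow, h1, Complex.norm_real, Real.norm_of_nonneg (Real.sqrt_nonneg _),
    Real.sq_sqrt (norm_nonneg _), mul_div_cancel₀ _ (norm_ne_zero_iff.2 h0)]

/-! ### The normalized density and its bound near infinity -/

namespace Polynomial

variable {P : ℂ[X]}

/-- The density of the normalized length of level sets. -/
noncomputable def normalizedDensity (P : ℂ[X]) (s : ℂ) : ℝ :=
  P.lengthDensity s * Real.exp (-s.re / P.natDegree)

theorem isSumNormSqAt_normalizedDensity (h1 : 1 ≤ P.natDegree) {s : ℂ}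
    (hs : ∀ z, P.eval z = Complex.exp s → P.derivative.eval z ≠ 0) :
    IsSumNormSqAt P.normalizedDensity s := by
  obtain ⟨Z, hZ⟩ := exists_isBranchSystem h1 hs
  -- Near `s` this is `exp (-w / n) * (Z i)' w`, since `P'(Z i) * (Z i)' = exp`.
  set g : ℂ → ℂ → ℂ := fun i w =>
    Complex.exp (w - w / P.natDegree) / P.derivative.eval (Z i w) with hg
  have hPa : ∀ i ∈ P.fiber (Complex.exp s), P.derivative.eval (Z i s) ≠ 0 := by
    intro i hi
    rw [hZ.apply_self i hi]
    exact hs i ((mem_fiber h1).1 hi)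
  have hga : ∀ i ∈ P.fiber (Complex.exp s), AnalyticAt ℂ (g i) s := by
    intro i hi
    have h2 : AnalyticAt ℂ (fun w => P.derivative.eval (Z i w)) s :=
      (AnalyticOnNhd.eval_polynomial P.derivative (Z i s) trivial).comp (hZ.analyticAt i hi)
    have h3 : AnalyticAt ℂ (fun w : ℂ => Complex.exp (w - w / P.natDegree)) s := by
      have hn : (P.natDegree : ℂ) ≠ 0 := by exact_mod_cast (by omega : P.natDegree ≠ 0)
      fun_prop (disch := exact hn)
    exact h3.div h2 (hPa i hi)
  have hex := fun i (hi : i ∈ P.fiber (Complex.exp s)) => (hga i hi).exists_norm_eq_norm_sq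
    (div_ne_zero (Complex.exp_ne_zero _) (hPa i hi))
  choose! h hh hgh using hex
  refine ⟨P.fiber (Complex.exp s), h, hh, ?_⟩
  filter_upwards [hZ.sum_fiber fun z => ‖P.derivative.eval z‖⁻¹,
    (Finset.eventually_all _).2 hgh] with w hw1 hw2
  rw [normalizedDensity, lengthDensity, invDerivSum, hw1, mul_right_comm, Finset.mul_sum]
  refine Finset.sum_congr rfl fun i hi => ?_
  rw [← hw2 i hi, hg, norm_div, Complex.norm_exp, ← Real.exp_add, Complex.sub_re,
    Complex.div_natCast_re, div_eq_mul_inv _ ‖_‖, neg_div, sub_eq_add_neg]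

theorem periodic_normalizedDensity (P : ℂ[X]) :
    Function.Periodic P.normalizedDensity (2 * Real.pi * Complex.I) := by
  intro s
  simp [normalizedDensity, lengthDensity, Complex.exp_periodic s]

theorem verticalIntegral_normalizedDensity (P : ℂ[X]) (t : ℝ) :
    verticalIntegral P.normalizedDensity t =
      (∫ θ in (-Real.pi)..Real.pi, P.lengthDensity (t + θ * Complex.I)) *
        Real.exp (-t / P.natDegree) := by
  rw [verticalIntegral, ← intervalIntegral.integral_mul_const]
  simp [normalizedDensity]

theorem exists_verticalIntegral_normalizedDensity_le (hP : P.Monic) (h1 : 1 ≤ P.natDegree) :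
    ∃ M C : ℝ, ∀ t, M ≤ t → verticalIntegral P.normalizedDensity t ≤ C := by
  obtain ⟨M, C, hMC⟩ := exists_invDerivSum_le_of_large hP h1
  -- The maximum with `1` makes the logarithm meaningful when `M ≤ 0`.
  refine ⟨Real.log (max M 1), C * (2 * Real.pi), fun t ht => ?_⟩
  have hM : M ≤ Real.exp t := by
    rw [Real.log_le_iff_le_exp (lt_max_of_lt_right one_pos)] at ht
    exact (le_max_left _ _).trans ht
  have hb : ∀ θ : ℝ, P.normalizedDensity (t + θ * Complex.I) ≤ C := by
    intro θ
    have hre : ((t : ℂ) + θ * Complex.I).re = t := by simp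
    have h2 := hMC (Complex.exp (t + θ * Complex.I)) (by rwa [Complex.norm_exp, hre])
    rw [Complex.norm_exp, hre, ← Real.exp_mul, branchExponent] at h2
    rw [normalizedDensity, lengthDensity, hre, mul_right_comm, ← Real.exp_add]
    convert h2 using 3
    ring
  have h3 := intervalIntegral.norm_integral_le_of_norm_le_const (a := -Real.pi) (b := Real.pi)
    (f := fun θ : ℝ => P.normalizedDensity (t + θ * Complex.I)) (C := C) fun θ _ => by
      rw [normalizedDensity, Real.norm_of_nonneg (mul_nonneg (lengthDensity_nonneg _ _) (Real.exp_nonneg _))]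
      exact hb θ
  refine (le_abs_self _).trans (h3.trans_eq ?_)
  rw [abs_of_nonneg (by linarith [Real.pi_pos])]
  ring

end Polynomial

/-! ### Level sets in extended real terms and the main theorem -/

theorem levelSet_eval_eq_expLevelSet (P : Polynomial ℂ) (t : ℝ) :
    levelSet (fun z => P.eval z) t = P.expLevelSet t := by
  ext z
  have h : ((t : ℝ) : EReal) = ENNReal.log (ENNReal.ofReal (Real.exp t)) := by
    rw [ENNReal.log_ofReal_of_pos (Real.exp_pos t), Real.log_exp]
  have h2 : ‖P.eval z‖ₑ = ENNReal.ofReal ‖P.eval z‖ := (ofReal_norm _).symm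
  change logAbs (P.eval z) = t ↔ ‖P.eval z‖ = Real.exp t
  rw [logAbs, h, ENNReal.log_injective.eq_iff, h2,
    ENNReal.ofReal_eq_ofReal_iff (norm_nonneg _) (Real.exp_nonneg _)]

theorem derivative_eval_ne_zero_of_largestCriticalValue_lt {P : Polynomial ℂ} {s : ℂ}
    (hs : largestCriticalValue P < (s.re : EReal)) (z : ℂ) (hz : P.eval z = Complex.exp s) :
    P.derivative.eval z ≠ 0 := by
  intro h
  have h1 : logAbs (P.eval z) ≤ largestCriticalValue P :=
    le_iSup₂ (f := fun ζ (_ : ζ ∈ {z : ℂ | P.derivative.IsRoot z}) => logAbs (P.eval ζ)) z h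
  have h2 : logAbs (P.eval z) = s.re := by
    rw [logAbs, hz, ← ofReal_norm, Complex.norm_exp,
      ENNReal.log_ofReal_of_pos (Real.exp_pos _), Real.log_exp]
  rw [h2] at h1
  exact absurd hs (not_lt.2 h1)

theorem mainTheorem12 (n : ℕ) (hn : 1 ≤ n) (P : Polynomial ℂ) (hP : P.Monic)
    (hdeg : P.natDegree = n) :
    (∀ t : ℝ, largestCriticalValue P ≤ (t : EReal) →
      planeLength (levelSet (fun z => P.eval z) t) < ⊤) ∧
    CompletelyMonotonicIco
      (fun t : ℝ => (planeLength (levelSet (fun z => P.eval z) t)).toReal * Real.exp (-t / n))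
      (largestCriticalValue P) ⊤ := by
  subst hdeg
  have hf : (fun t : ℝ => (planeLength (levelSet (fun z => P.eval z) t)).toReal *
      Real.exp (-t / P.natDegree)) = verticalIntegral P.normalizedDensity := by
    ext t
    rw [Polynomial.verticalIntegral_normalizedDensity, levelSet_eval_eq_expLevelSet, planeLength,
      Polynomial.toReal_hausdorffMeasure_expLevelSet hn]
  refine ⟨fun t _ => ?_, ?_⟩
  · rw [levelSet_eval_eq_expLevelSet]
    exact Polynomial.hausdorffMeasure_expLevelSet_lt_top hP hn t
  rw [hf]
  set J : Set ℝ := {t | largestCriticalValue P < (t : EReal)} with hJ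
  have hJo : IsOpen J := isOpen_Ioi.preimage continuous_coe_real_ereal
  have hJu : IsUpperSet J := fun a b hab ha => lt_of_lt_of_le ha (EReal.coe_le_coe_iff.2 hab)
  obtain ⟨M, C, hMC⟩ := Polynomial.exists_verticalIntegral_normalizedDensity_le hP hn
  obtain ⟨h1, h2⟩ := verticalIntegral_completelyMonotone hJo hJu (Φ := P.normalizedDensity)
    (fun s hs => Polynomial.isSumNormSqAt_normalizedDensity hn
      (derivative_eval_ne_zero_of_largestCriticalValue_lt hs))
    P.periodic_normalizedDensity (fun t _ => hMC t)
  refine ⟨Continuous.continuousOn ?_, ?_, fun k t ht _ => h2 k t ht⟩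
  · rw [← hf]
    simp_rw [levelSet_eval_eq_expLevelSet, planeLength,
      Polynomial.toReal_hausdorffMeasure_expLevelSet hn]
    exact (Polynomial.continuous_integral_lengthDensity hP hn).mul (by fun_prop)
  · exact h1.mono fun t ht => ht.1
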